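/- A finite graph is planar if it can be drawn in the Euclidean plane with its vertices as distinct points and its edges as simple polygonal arcs joining their end vertices, such that no edge passes through a vertex other than its ends and two different edges meet only in common end vertices. The thickness $\theta(G)$ of a finite graph $G$ is the minimum number of planar subgraphs of $G$ whose union is $G$. Let $K_{1,n,n}$ be the complete $3$-partite graph whose parts have $1$, $n$ and $n$ vertices. Theorem. For every integer $n \ge 1$, $$\theta(K_{1,n,n}) = \left\lceil \frac{n+2}{4} \right\rceil .$$ -/

import Mathlib

/-- `IsPolygonalArc a b A`: the set `A` is a simple polygonal arc in the Euclidean plane with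
end points `a` and `b`. That is, `A` is the trace of a polygonal chain
`a = p 0, p 1, …, p m = b` with `m ≥ 1` nondegenerate segments which does not touch or cross
itself: consecutive segments share only their common end point, and any two other segments are
disjoint. -/
def IsPolygonalArc (a b : ℝ × ℝ) (A : Set (ℝ × ℝ)) : Prop :=
  ∃ (m : ℕ) (p : ℕ → ℝ × ℝ), 0 < m ∧ p 0 = a ∧ p m = b ∧
    (∀ i < m, p i ≠ p (i + 1)) ∧
    (∀ i, i + 1 < m →
      segment ℝ (p i) (p (i + 1)) ∩ segment ℝ (p (i + 1)) (p (i + 2)) = {p (i + 1)}) ∧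
    (∀ i j, i + 1 < j → j < m →
      Disjoint (segment ℝ (p i) (p (i + 1))) (segment ℝ (p j) (p (j + 1)))) ∧
    A = ⋃ i ∈ Set.Iio m, segment ℝ (p i) (p (i + 1))

/-- A drawing of the graph `G` in the plane without crossings: the vertices are distinct points,
every edge `uv` is a simple polygonal arc joining the points of `u` and `v` and containing no
other vertex, and two different edges meet only in common end vertices.
(The values of `arc` outside the edge set of `G` play no role.) -/
structure PlaneDrawing {V : Type*} (G : SimpleGraph V) where
  pos : V → ℝ × ℝ
  pos_injective : Function.Injective pos
  arc : Sym2 V → Set (ℝ × ℝ)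
  isPolygonalArc : ∀ u v, G.Adj u v → IsPolygonalArc (pos u) (pos v) (arc s(u, v))
  vertex_on_edge : ∀ e ∈ G.edgeSet, ∀ w, pos w ∈ arc e → w ∈ e
  edge_inter_edge : ∀ e ∈ G.edgeSet, ∀ f ∈ G.edgeSet, e ≠ f →
    ∀ x ∈ arc e ∩ arc f, ∃ w, w ∈ e ∧ w ∈ f ∧ x = pos w

/-- A graph is planar if it can be drawn in the plane without crossings. -/
def IsPlanar {V : Type*} (G : SimpleGraph V) : Prop :=
  Nonempty (PlaneDrawing G)

/-- `G` is the union of `k` (not necessarily distinct or edge-disjoint) planar subgraphs. -/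
def IsUnionOfPlanarSubgraphs {V : Type*} (G : SimpleGraph V) (k : ℕ) : Prop :=
  ∃ H : Fin k → G.Subgraph, (∀ i, IsPlanar (H i).coe) ∧ ⨆ i, H i = ⊤

/-- The thickness of `G`: the minimum number of planar subgraphs whose union is `G`
(`⊤` if there is no such finite number). -/
noncomputable def thickness {V : Type*} (G : SimpleGraph V) : ℕ∞ :=
  sInf {t : ℕ∞ | ∃ k : ℕ, t = (k : ℕ∞) ∧ IsUnionOfPlanarSubgraphs G k}

/-- The complete 3-partite graph `K_{a,b,c}`. -/
abbrev completeTripartite (a b c : ℕ) :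
    SimpleGraph (Σ i : Fin 3, Fin ((![a, b, c] : Fin 3 → ℕ) i)) :=
  SimpleGraph.completeMultipartiteGraph fun i : Fin 3 => Fin ((![a, b, c] : Fin 3 → ℕ) i)

/-!
Let `n` be one of `4p - 1, …, 4p + 2`, so that the claimed value is `p + 1`.

*Upper bound.* It suffices to write `K_{1,4p+2,4p+2}` as a union of `p + 1` planar graphs. The two
large parts are divided into `p` blocks of four vertices and an incomplete block of two vertices.
For `r < p` the piece `r` consists of ten of the sixteen edges inside block `r`, of the edges that
join the other vertices to a suitable pair of vertices of the block, and of the edges from the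
apex to six vertices of block `r` and, if `r + 1 < p`, to two vertices of the next block.
The last piece takes what remains: two strips, each running between two vertices of the incomplete
block, the four edges inside that block, and a few edges at the apex. Planarity of all pieces is
shown by two-page book embeddings (`isPlanar_of_twoPage`): the vertices are put on a line, the edges
on the two sides of it, and what has to be checked is that no two edges of the same side interleave,
which is linear arithmetic in the positions.

*Lower bound.* Let `n ≥ 2`. A planar subgraph has at most `4n - 4` of the `n ^ 2` edges between the large parts
(`card_le_of_isPlanar`), and `n ^ 2 ≤ k (4n - 4)` forces `k ≥ (n + 2) / 4`. The bound `4n - 4` is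
Euler's bound for bipartite plane graphs, `PolylineDrawing.card_add_four_le`, and it is proved
without the Jordan curve theorem, by sweeping a vertical line over the drawing. All arcs are cut
into segments, whose ends have distinct abscissas after a shear. A region is named after any of
the segments that bound it from below; at each point `w` of the drawing one pair of names has to be
identified, namely those of the region directly above `w` as seen from the left and from the right,
and one of these identifications is redundant, as the outer region surrounds the drawing. This
leaves at least `E - V + 2` classes of names
(`StraightDrawing.exists_compatible`). On the other hand the class on the left of a directed edge
is also the class on the left of some next edge (`StraightDrawing.exists_next`), so that each class
belongs to at least four of the `2E` directed edges if there are no vertices of degree one.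
Only these two facts about the classes are needed; that they are the regions of the plane is not.
-/

/-! ### Segments as graphs of affine functions -/

/-- The height at abscissa `x` of the line through `a` and `b`; meaningful if `a.1 ≠ b.1`. -/
noncomputable def lineHeight (a b : ℝ × ℝ) (x : ℝ) : ℝ :=
  a.2 + (x - a.1) * ((b.2 - a.2) / (b.1 - a.1))

theorem lineHeight_left (a b : ℝ × ℝ) : lineHeight a b a.1 = a.2 := by
  simp [lineHeight]

theorem lineHeight_right {a b : ℝ × ℝ} (h : a.1 < b.1) : lineHeight a b b.1 = b.2 := by
  have : b.1 - a.1 ≠ 0 := by linarith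
  unfold lineHeight
  field_simp
  ring

theorem mem_segment_iff_of_fst_lt {a b : ℝ × ℝ} (h : a.1 < b.1) (z : ℝ × ℝ) :
    z ∈ segment ℝ a b ↔ a.1 ≤ z.1 ∧ z.1 ≤ b.1 ∧ z.2 = lineHeight a b z.1 := by
  have hne : b.1 - a.1 ≠ 0 := by linarith
  have hpos : 0 < b.1 - a.1 := by linarith
  constructor
  · rintro ⟨s, t, hs, ht, hst, rfl⟩
    obtain rfl : s = 1 - t := by linarith
    simp only [Prod.fst_add, Prod.smul_fst, smul_eq_mul, Prod.snd_add, Prod.smul_snd, lineHeight]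
    refine ⟨by nlinarith, by nlinarith, ?_⟩
    field_simp
    ring
  · rintro ⟨h1, h2, h3⟩
    refine ⟨(b.1 - z.1) / (b.1 - a.1), (z.1 - a.1) / (b.1 - a.1), by
      apply div_nonneg <;> linarith, by apply div_nonneg <;> linarith, by field_simp; ring, ?_⟩
    refine Prod.ext ?_ ?_
    · simp only [Prod.fst_add, Prod.smul_fst, smul_eq_mul]
      field_simp
      ring
    · simp only [Prod.snd_add, Prod.smul_snd, smul_eq_mul, h3, lineHeight]
      field_simp
      ring

/-! ### Two-page book embeddings -/

theorem isPolygonalArc_of_two {a b c : ℝ × ℝ} (hac : a ≠ c) (hcb : c ≠ b)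
    (h : segment ℝ a c ∩ segment ℝ c b = {c}) :
    IsPolygonalArc a b (segment ℝ a c ∪ segment ℝ c b) := by
  refine ⟨2, fun i => if i = 0 then a else if i = 1 then c else b, by norm_num, by simp, by simp,
    ?_, ?_, ?_, ?_⟩
  · intro i hi
    interval_cases i <;> simpa
  · intro i hi
    obtain rfl : i = 0 := by omega
    simpa using h
  · intro i j hij hj
    omega
  · have : Set.Iio 2 = ({0, 1} : Set ℕ) := by
      ext i
      simp only [Set.mem_Iio, Set.mem_insert_iff, Set.mem_singleton_iff]
      omega
    rw [this]
    simp

/-- The arc drawn for an edge of a book embedding whose ends have abscissas `l < r` on the spine: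
two segments of slopes `± σ (r - l)`. The slope grows with the width, so that nested arcs
on the same side of the spine meet in common ends only. -/
def tentArc (σ l r : ℝ) : Set (ℝ × ℝ) :=
  {z | l ≤ z.1 ∧ z.1 ≤ r ∧ z.2 = σ * ((r - l) * min (z.1 - l) (r - z.1))}

theorem tentArc_eq (σ : ℝ) {l r : ℝ} (h : l < r) :
    tentArc σ l r = segment ℝ (l, 0) ((l + r) / 2, σ * (r - l) ^ 2 / 2) ∪
      segment ℝ ((l + r) / 2, σ * (r - l) ^ 2 / 2) (r, 0) := by
  have hrl : r - l ≠ 0 := by linarith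
  ext ⟨x, y⟩
  rw [Set.mem_union, mem_segment_iff_of_fst_lt (by simp only; linarith),
    mem_segment_iff_of_fst_lt (by simp only; linarith)]
  simp only [tentArc, Set.mem_ofPred_eq, lineHeight]
  have e1 : ((σ * (r - l) ^ 2 / 2 - 0) / ((l + r) / 2 - l)) = σ * (r - l) := by
    rw [div_eq_iff (by intro h; apply hrl; linarith)]
    ring
  have e2 : ((0 - σ * (r - l) ^ 2 / 2) / (r - (l + r) / 2)) = - (σ * (r - l)) := by
    rw [div_eq_iff (by intro h; apply hrl; linarith)]
    ring
  rw [e1, e2]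
  constructor
  · rintro ⟨h1, h2, h3⟩
    rcases le_total x ((l + r) / 2) with hx | hx
    · left
      rw [min_eq_left (by linarith)] at h3
      exact ⟨h1, hx, by rw [h3]; ring⟩
    · right
      rw [min_eq_right (by linarith)] at h3
      exact ⟨hx, h2, by rw [h3]; ring⟩
  · rintro (⟨h1, h2, h3⟩ | ⟨h1, h2, h3⟩)
    · refine ⟨h1, by linarith, ?_⟩
      rw [min_eq_left (by linarith), h3]
      ring
    · refine ⟨by linarith, h2, ?_⟩
      rw [min_eq_right (by linarith), h3]
      ring

theorem isPolygonalArc_tentArc (σ : ℝ) {l r : ℝ} (h : l < r) :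
    IsPolygonalArc (l, 0) (r, 0) (tentArc σ l r) ∧
      IsPolygonalArc (r, 0) (l, 0) (tentArc σ l r) := by
  have key : segment ℝ ((l, 0) : ℝ × ℝ) ((l + r) / 2, σ * (r - l) ^ 2 / 2) ∩
      segment ℝ ((l + r) / 2, σ * (r - l) ^ 2 / 2) (r, 0) =
        {((l + r) / 2, σ * (r - l) ^ 2 / 2)} := by
    apply Set.Subset.antisymm
    · rintro ⟨x, y⟩ ⟨h1, h2⟩
      rw [mem_segment_iff_of_fst_lt (by simp only; linarith)] at h1 h2
      obtain ⟨-, h1, -⟩ := h1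
      obtain ⟨h2, -, h3⟩ := h2
      simp only at h1 h2 h3
      obtain rfl : x = (l + r) / 2 := le_antisymm h1 h2
      simp only [lineHeight, sub_self, zero_mul, add_zero] at h3
      simp [h3]
    · rintro _ rfl
      exact ⟨right_mem_segment ℝ _ _, left_mem_segment ℝ _ _⟩
  have n1 : ((l, 0) : ℝ × ℝ) ≠ ((l + r) / 2, σ * (r - l) ^ 2 / 2) := fun e => by
    have := congrArg Prod.fst e
    simp only at this
    linarith
  have n2 : (((l + r) / 2, σ * (r - l) ^ 2 / 2) : ℝ × ℝ) ≠ (r, 0) := fun e => by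
    have := congrArg Prod.fst e
    simp only at this
    linarith
  rw [tentArc_eq σ h]
  refine ⟨isPolygonalArc_of_two n1 n2 key, ?_⟩
  rw [segment_symm ℝ (l, 0), segment_symm ℝ _ (r, 0), Set.inter_comm] at key
  have := isPolygonalArc_of_two n2.symm n1.symm key
  rwa [Set.union_comm, segment_symm ℝ (r, 0), segment_symm ℝ _ (l, 0)] at this

theorem eq_ends_of_mem_tentArc {σ l r x : ℝ} (hσ : σ ≠ 0) (h : l < r)
    (hx : (x, 0) ∈ tentArc σ l r) : x = l ∨ x = r := by
  obtain ⟨h1, h2, h3⟩ := hx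
  simp only at h1 h2 h3
  have h4 : (r - l) * min (x - l) (r - x) = 0 := by
    rcases mul_eq_zero.1 h3.symm with h | h
    · exact absurd h hσ
    · exact h
  rcases mul_eq_zero.1 h4 with h5 | h5
  · linarith
  · rcases min_choice (x - l) (r - x) with h6 | h6
    · left; linarith
    · right; linarith

/-- Arcs of different intervals that do not interleave meet on the spine only. -/
theorem snd_eq_zero_of_mem_tentArc {σ l r l' r' : ℝ} {z : ℝ × ℝ}
    (hne : ¬ (l = l' ∧ r = r')) (h : l < r) (h' : l' < r')
    (h1 : ¬ (l < l' ∧ l' < r ∧ r < r')) (h2 : ¬ (l' < l ∧ l < r' ∧ r' < r))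
    (hz : z ∈ tentArc σ l r) (hz' : z ∈ tentArc σ l' r') : z.2 = 0 := by
  -- The symmetric core: the interval `[l', r']` is properly contained in `[l, r]`.
  have nested : ∀ {l r l' r' : ℝ}, ¬ (l = l' ∧ r = r') → l' < r' → l ≤ l' → r' ≤ r →
      z ∈ tentArc σ l r → z ∈ tentArc σ l' r' → z.2 = 0 := by
    rintro l r l' r' hne h' hl hr ⟨-, -, hz⟩ ⟨hz1, hz2, hz'⟩
    by_cases hσ : σ = 0
    · rw [hz, hσ, zero_mul]
    have hw : r' - l' < r - l := by
      rcases hl.lt_or_eq with h | h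
      · linarith
      · rcases hr.lt_or_eq with h5 | h5
        · linarith
        · exact absurd ⟨h, h5.symm⟩ hne
    have e : (r - l) * min (z.1 - l) (r - z.1) = (r' - l') * min (z.1 - l') (r' - z.1) :=
      mul_left_cancel₀ hσ (hz.symm.trans hz')
    have m1 : min (z.1 - l') (r' - z.1) ≤ min (z.1 - l) (r - z.1) :=
      min_le_min (by linarith) (by linarith)
    have m0 : 0 ≤ min (z.1 - l') (r' - z.1) := le_min (by linarith) (by linarith)
    have : min (z.1 - l') (r' - z.1) = 0 := by nlinarith
    rw [hz', this, mul_zero, mul_zero]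
  obtain ⟨a1, a2, a3⟩ := id hz
  obtain ⟨b1, b2, b3⟩ := id hz'
  rcases le_total l l' with hl | hl
  · rcases le_or_gt r' r with hr | hr
    · exact nested hne h' hl hr hz hz'
    · rcases hl.lt_or_eq with hl | hl
      · have : r ≤ l' := by
          by_contra hcon
          exact h1 ⟨hl, not_le.1 hcon, hr⟩
        have : z.1 = r := by linarith
        rw [a3, this, sub_self, min_eq_right (by linarith), mul_zero, mul_zero]
      · exact nested (fun e => hne ⟨e.1.symm, e.2.symm⟩) h hl.ge hr.le hz' hz
  · rcases le_or_gt r r' with hr | hr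
    · exact nested (fun e => hne ⟨e.1.symm, e.2.symm⟩) h hl hr hz' hz
    · rcases hl.lt_or_eq with hl | hl
      · have : r' ≤ l := by
          by_contra hcon
          exact h2 ⟨hl, not_le.1 hcon, hr⟩
        have : z.1 = l := by linarith
        rw [a3, this, sub_self, min_eq_left (by linarith), mul_zero, mul_zero]
      · exact nested hne h' hl.ge hr.le hz hz'

/-- A graph with a book embedding on two pages is planar: the vertices can be placed on a line
(the spine) in an order `pos`, and each edge on one of two pages, so that no two edges of the same
page interleave. Only the values `up a b` with `pos a < pos b` matter. -/
theorem isPlanar_of_twoPage {V : Type*} (G : SimpleGraph V) (pos : V → ℤ)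
    (hpos : Function.Injective pos) (up : V → V → Prop)
    (hup : ∀ a b c d, G.Adj a b → G.Adj c d → pos a < pos c → pos c < pos b → pos b < pos d →
      (up a b ↔ ¬ up c d)) : IsPlanar G := by
  classical
  let σ : V → V → ℝ := fun a b => if up a b then 1 else -1
  have hσ : ∀ a b, σ a b ≠ 0 := fun a b => by
    by_cases h : up a b <;> simp [σ, h]
  let arc : Sym2 V → Set (ℝ × ℝ) := fun e =>
    {z | ∃ a b, e = s(a, b) ∧ pos a < pos b ∧ z ∈ tentArc (σ a b) (pos a) (pos b)}
  have arc_eq : ∀ a b, pos a < pos b → arc s(a, b) = tentArc (σ a b) (pos a) (pos b) := by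
    intro a b hab
    ext z
    constructor
    · rintro ⟨a', b', he, hlt, hz⟩
      rcases Sym2.eq_iff.1 he with ⟨rfl, rfl⟩ | ⟨rfl, rfl⟩
      · exact hz
      · omega
    · intro hz
      exact ⟨a, b, rfl, hab, hz⟩
  have ends : ∀ a b, pos a < pos b → ∀ x : ℝ, (x, 0) ∈ arc s(a, b) → x = pos a ∨ x = pos b := by
    intro a b hab x hx
    rw [arc_eq a b hab] at hx
    exact eq_ends_of_mem_tentArc (hσ a b) (by exact_mod_cast hab) hx
  have orient : ∀ e ∈ G.edgeSet, ∃ a b, e = s(a, b) ∧ G.Adj a b ∧ pos a < pos b := by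
    intro e
    induction e using Sym2.ind with
    | _ a b =>
      intro he
      rw [SimpleGraph.mem_edgeSet] at he
      rcases lt_or_gt_of_ne (fun h => he.ne (hpos h)) with h | h
      · exact ⟨a, b, rfl, he, h⟩
      · exact ⟨b, a, Sym2.eq_swap, he.symm, h⟩
  have spine : ∀ e ∈ G.edgeSet, ∀ z ∈ arc e, z.2 = 0 → ∃ w ∈ e, z = ((pos w : ℝ), 0) := by
    rintro e he ⟨x, y⟩ hz hy
    obtain ⟨a, b, rfl, hab, hlt⟩ := orient e he
    simp only at hy
    subst hy
    rcases ends a b hlt x hz with rfl | rfl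
    · exact ⟨a, by simp, rfl⟩
    · exact ⟨b, by simp, rfl⟩
  have pinj : Function.Injective fun v => ((pos v : ℝ), (0 : ℝ)) := fun v w h => by
    have : (pos v : ℝ) = pos w := congrArg Prod.fst h
    exact hpos (by exact_mod_cast this)
  refine ⟨⟨fun v => ((pos v : ℝ), 0), pinj, arc, ?_, ?_, ?_⟩⟩
  · intro u v huv
    rcases lt_or_gt_of_ne (fun h => huv.ne (hpos h)) with h | h
    · rw [arc_eq u v h]
      exact (isPolygonalArc_tentArc _ (by exact_mod_cast h)).1
    · rw [Sym2.eq_swap, arc_eq v u h]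
      exact (isPolygonalArc_tentArc _ (by exact_mod_cast h)).2
  · intro e he w hw
    obtain ⟨w', hw', h⟩ := spine e he _ hw rfl
    rwa [pinj h]
  · rintro e he f hf hne z ⟨hze, hzf⟩
    suffices h0 : z.2 = 0 by
      obtain ⟨w, hw, h⟩ := spine e he z hze h0
      obtain ⟨w', hw', h'⟩ := spine f hf z hzf h0
      obtain rfl : w = w' := pinj (h.symm.trans h')
      exact ⟨w, hw, hw', h⟩
    obtain ⟨a, b, rfl, hab, hlt⟩ := orient e he
    obtain ⟨c, d, rfl, hcd, hlt'⟩ := orient f hf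
    rw [arc_eq a b hlt] at hze
    rw [arc_eq c d hlt'] at hzf
    have hltR : (pos a : ℝ) < pos b := by exact_mod_cast hlt
    have hltR' : (pos c : ℝ) < pos d := by exact_mod_cast hlt'
    by_cases hs : up a b ↔ up c d
    · have hs' : σ a b = σ c d := by simp only [σ, hs]
      rw [← hs'] at hzf
      refine snd_eq_zero_of_mem_tentArc ?_ hltR hltR' ?_ ?_ hze hzf
      · rintro ⟨h1, h2⟩
        apply hne
        rw [hpos (by exact_mod_cast h1 : pos a = pos c), hpos (by exact_mod_cast h2 : pos b = pos d)]
      · rintro ⟨h1, h2, h3⟩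
        have := hup a b c d hab hcd (by exact_mod_cast h1) (by exact_mod_cast h2)
          (by exact_mod_cast h3)
        tauto
      · rintro ⟨h1, h2, h3⟩
        have := hup c d a b hcd hab (by exact_mod_cast h1) (by exact_mod_cast h2)
          (by exact_mod_cast h3)
        tauto
    · -- The arcs lie on different sides of the spine.
      obtain ⟨a1, a2, a3⟩ := hze
      obtain ⟨b1, b2, b3⟩ := hzf
      have pa : 0 ≤ ((pos b : ℝ) - pos a) * min (z.1 - pos a) (pos b - z.1) :=
        mul_nonneg (by linarith) (le_min (by linarith) (by linarith))
      have pb : 0 ≤ ((pos d : ℝ) - pos c) * min (z.1 - pos c) (pos d - z.1) :=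
        mul_nonneg (by linarith) (le_min (by linarith) (by linarith))
      by_cases h1 : up a b
      · have h2 : ¬ up c d := by tauto
        simp only [σ, h1, h2, if_true, if_false] at a3 b3
        linarith
      · have h2 : up c d := by tauto
        simp only [σ, h1, h2, if_true, if_false] at a3 b3
        linarith

/-! ### Decomposing `K_{1,n,n}` into planar graphs -/

theorem IsPlanar.of_injective {V W : Type*} {G : SimpleGraph V} {G' : SimpleGraph W}
    (h : IsPlanar G') (f : V → W) (hf : Function.Injective f)
    (hadj : ∀ a b, G.Adj a b → G'.Adj (f a) (f b)) : IsPlanar G := by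
  obtain ⟨D⟩ := h
  have hmap : ∀ e ∈ G.edgeSet, e.map f ∈ G'.edgeSet := by
    intro e
    induction e using Sym2.ind with
    | _ a b => exact hadj a b
  refine ⟨⟨fun v => D.pos (f v), D.pos_injective.comp hf, fun e => D.arc (e.map f), ?_, ?_, ?_⟩⟩
  · intro u v huv
    exact D.isPolygonalArc _ _ (hadj u v huv)
  · intro e he w hw
    obtain ⟨w', hw', h⟩ := Sym2.mem_map.1 (D.vertex_on_edge _ (hmap e he) _ hw)
    rwa [← hf h]
  · intro e he g hg hne x hx
    obtain ⟨w, hw, hw', rfl⟩ := D.edge_inter_edge _ (hmap e he) _ (hmap g hg)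
      (fun h => hne (Sym2.map.injective hf h)) x hx
    obtain ⟨a, ha, rfl⟩ := Sym2.mem_map.1 hw
    obtain ⟨b, hb, h⟩ := Sym2.mem_map.1 hw'
    obtain rfl := hf h
    exact ⟨b, ha, hb, rfl⟩

/-- A form of `isPlanar_of_twoPage` in which the two pages are given as the sets `U` and `D` of the
intervals that their edges span. -/
theorem isPlanar_fromRel_of_twoPage {V : Type*} (R : V → V → Prop) (pos : V → ℤ)
    (hpos : Function.Injective pos) (U D : ℤ → ℤ → Prop)
    (hU : ∀ l r l' r', U l r → U l' r' → ¬ (l < l' ∧ l' < r ∧ r < r'))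
    (hD : ∀ l r l' r', D l r → D l' r' → ¬ (l < l' ∧ l' < r ∧ r < r'))
    (hU_lt : ∀ l r, U l r → l < r) (hD_lt : ∀ l r, D l r → l < r)
    (hR : ∀ a b, R a b → U (pos a) (pos b) ∨ U (pos b) (pos a) ∨
      D (pos a) (pos b) ∨ D (pos b) (pos a)) :
    IsPlanar (SimpleGraph.fromRel R) := by
  have key : ∀ a b, (SimpleGraph.fromRel R).Adj a b → pos a < pos b →
      U (pos a) (pos b) ∨ D (pos a) (pos b) := by
    intro a b hab hlt
    rcases ((SimpleGraph.fromRel_adj R a b).1 hab).2 with h | h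
    · rcases hR _ _ h with h | h | h | h
      · exact Or.inl h
      · exact absurd (hU_lt _ _ h) hlt.not_gt
      · exact Or.inr h
      · exact absurd (hD_lt _ _ h) hlt.not_gt
    · rcases hR _ _ h with h | h | h | h
      · exact absurd (hU_lt _ _ h) hlt.not_gt
      · exact Or.inl h
      · exact absurd (hD_lt _ _ h) hlt.not_gt
      · exact Or.inr h
  refine isPlanar_of_twoPage _ pos hpos (fun a b => U (pos a) (pos b)) ?_
  intro a b c d hab hcd h1 h2 h3
  constructor
  · intro h h'
    exact hU _ _ _ _ h h' ⟨h1, h2, h3⟩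
  · intro h'
    by_contra h
    exact hD _ _ _ _ ((key a b hab (h1.trans h2)).resolve_left h)
      ((key c d hcd (h2.trans h3)).resolve_left h') ⟨h1, h2, h3⟩

theorem isUnionOfPlanarSubgraphs_of_iSup {V : Type*} {G : SimpleGraph V} {k : ℕ} (hk : 0 < k)
    (H : ℕ → SimpleGraph V) (hH : ∀ r < k, IsPlanar (H r))
    (hcover : ∀ a b, G.Adj a b → ∃ r < k, (H r).Adj a b) :
    IsUnionOfPlanarSubgraphs G k := by
  refine ⟨fun r => SimpleGraph.toSubgraph (G ⊓ H r) inf_le_left, fun r => ?_, ?_⟩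
  · refine (hH r r.2).of_injective Subtype.val Subtype.val_injective ?_
    rintro a b hab
    exact hab.2
  · apply top_unique
    refine ⟨fun v _ => ?_, fun a b hab => ?_⟩
    · simp only [SimpleGraph.Subgraph.verts_iSup, Set.mem_iUnion]
      exact ⟨⟨0, hk⟩, trivial⟩
    · obtain ⟨r, hr, h⟩ := hcover a b hab
      rw [SimpleGraph.Subgraph.iSup_adj]
      exact ⟨⟨r, hr⟩, hab, h⟩

/-- The vertices of `K_{1,N,N}`: the apex and the vertices `left i` and `right j` of the two large
parts. -/
inductive TripartiteVertex (N : ℕ) : Type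
  | apex
  | left (i : Fin N)
  | right (j : Fin N)

/-- The piece of the decomposition of `K_{1,4p+2,4p+2}` that contains the edge between `left i` and
`right j`. The index `i` belongs to block `i / 4`, which is one of `0, …, p - 1` or the incomplete
block `p`; within its block it has the side `i % 2` and the rank `i / 2 % 2`. For `r < p` the piece
`r` is built around the eight vertices of block `r`, while the piece `p` collects the remaining
edges. -/
def pieceLR (p i j : ℕ) : ℕ :=
  if i / 4 = j / 4 then
    if i / 4 < p ∧ (i % 2 ≠ j % 2 ∨ (i / 2 % 2 = 1 ∧ j / 2 % 2 = 1)) then i / 4 else p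
  else if i % 2 ≠ j % 2 then i / 4
  else if i / 4 = j / 4 + 1 ∧ i / 4 < p ∧ i / 2 % 2 = 0 ∧ j / 2 % 2 = 0 then p
  else j / 4

/-- The piece that contains the edge between the apex and `left i`. -/
def pieceL (p i : ℕ) : ℕ :=
  if i / 4 < p then if i / 2 % 2 = 1 then i / 4 else if i / 4 = 0 then p else i / 4 - 1 else p

/-- The edges of the piece `r` of the decomposition, each in one direction. -/
def pieceRel (p r : ℕ) : TripartiteVertex (4 * p + 2) → TripartiteVertex (4 * p + 2) → Prop
  | .apex, .left i => pieceL p i = r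
  | .apex, .right j => j / 4 = r
  | .left i, .right j => pieceLR p i j = r
  | _, _ => False

theorem exists_block_side_rank (i : ℕ) : ∃ t k h, k < 2 ∧ h < 2 ∧ i = 4 * t + 2 * k + h ∧
    i / 4 = t ∧ i % 2 = h ∧ i / 2 % 2 = k ∧ i % 4 = 2 * k + h :=
  ⟨i / 4, i / 2 % 2, i % 2, by omega, by omega, by omega, rfl, rfl, rfl, by omega⟩

/-- The order of the vertices on the spine for the piece `r < p`, where `B = 4p + 2`. The four
vertices `left i` of block `r` are at `0, 1, B + 4, B + 6`, the four vertices `right j` at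
`B + 5, 2B + 7, 2B + 8, 3B + 10`, and the apex is at `2`. The two vertices of the next block that
are joined to the apex in this piece are at `3` and `2B + 9`. Every other vertex is joined to two
vertices of block `r`, and lies in one of four intervals of length `B` according to this pair. -/
def blockPos (p r : ℕ) : TripartiteVertex (4 * p + 2) → ℤ
  | .apex => 2
  | .left i =>
    if (i : ℕ) / 4 = r then
      if (i : ℕ) % 4 = 0 then 0 else if (i : ℕ) % 4 = 2 then 1
      else if (i : ℕ) % 4 = 1 then (4 * p + 2) + 4 else (4 * p + 2) + 6
    else if (i : ℕ) / 4 = r + 1 ∧ (i : ℕ) / 4 < p ∧ (i : ℕ) / 2 % 2 = 0 then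
      if (i : ℕ) % 2 = 0 then 3 else 2 * (4 * p + 2) + 9
    else if (i : ℕ) % 2 = 0 then 4 + i else 2 * (4 * p + 2) + 10 + i
  | .right j =>
    if (j : ℕ) / 4 = r then
      if (j : ℕ) % 4 = 0 then (4 * p + 2) + 5 else if (j : ℕ) % 4 = 2 then 2 * (4 * p + 2) + 7
      else if (j : ℕ) % 4 = 1 then 3 * (4 * p + 2) + 10 else 2 * (4 * p + 2) + 8
    else if (j : ℕ) % 2 = 0 then (4 * p + 2) + 7 + j else 3 * (4 * p + 2) + 11 + j

/-- The intervals spanned by the edges on the upper page for a piece `r < p`, where `B = 4p + 2`. -/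
def BlockUp (B l r : ℤ) : Prop :=
  (l = 0 ∧ (r = 3 * B + 10 ∨ r = 2 * B + 8 ∨ 3 * B + 11 ≤ r)) ∨
  (l = 1 ∧ (r = 2 ∨ r = 2 * B + 7 ∨ r = 2 * B + 8)) ∨
  (l = 2 ∧ (r = 3 ∨ r = 2 * B + 7)) ∨
  (3 ≤ l ∧ l < B + 4 ∧ r = 2 * B + 7) ∨
  (l = B + 4 ∧ (r = B + 5 ∨ (B + 7 ≤ r ∧ r ≤ 2 * B + 7))) ∨
  (l = 2 * B + 8 ∧ 2 * B + 9 ≤ r ∧ r < 3 * B + 10)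

/-- The intervals spanned by the edges on the lower page for a piece `r < p`, where `B = 4p + 2`. -/
def BlockDown (B l r : ℤ) : Prop :=
  (l = 1 ∧ 3 * B + 10 ≤ r) ∨
  (l = 2 ∧ (r = B + 5 ∨ r = B + 6 ∨ r = 2 * B + 8 ∨ r = 2 * B + 9 ∨ r = 3 * B + 10)) ∨
  (4 ≤ l ∧ l < B + 4 ∧ r = B + 5) ∨
  (l = B + 5 ∧ r = B + 6) ∨
  (l = B + 6 ∧ B + 7 ≤ r ∧ r ≤ 2 * B + 8) ∨
  (2 * B + 10 ≤ l ∧ l < 3 * B + 10 ∧ r = 3 * B + 10)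

theorem blockPos_injective (p r : ℕ) : Function.Injective (blockPos p r) := by
  rintro (_ | i | i) (_ | j | j) h
  · rfl
  all_goals simp only [blockPos] at h
  case left.left => congr 1; ext; split_ifs at h <;> omega
  case right.right => congr 1; ext; split_ifs at h <;> omega
  all_goals exfalso; split_ifs at h <;> omega

theorem blockUp_not_interleaving {B : ℤ} (hB : 2 ≤ B) (l r l' r' : ℤ) (h : BlockUp B l r)
    (h' : BlockUp B l' r') : ¬ (l < l' ∧ l' < r ∧ r < r') := by
  unfold BlockUp at h h'
  rintro ⟨h1, h2, h3⟩
  rcases h with h | h | h | h | h | h <;> rcases h' with h' | h' | h' | h' | h' | h' <;> omega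

theorem blockDown_not_interleaving {B : ℤ} (hB : 2 ≤ B) (l r l' r' : ℤ) (h : BlockDown B l r)
    (h' : BlockDown B l' r') : ¬ (l < l' ∧ l' < r ∧ r < r') := by
  unfold BlockDown at h h'
  rintro ⟨h1, h2, h3⟩
  rcases h with h | h | h | h | h | h <;> rcases h' with h' | h' | h' | h' | h' | h' <;> omega

/-- The order of the vertices on the spine for the piece `p`: the apex, the even strip, the two
odd vertices of block `p`, the odd strip backwards, the two even vertices of block `p`.
A strip lists the vertices of one side, block by block. -/
def stripPos (p : ℕ) : TripartiteVertex (4 * p + 2) → ℤ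
  | .apex => 0
  | .left i =>
    if (i : ℕ) / 4 = p then if (i : ℕ) % 2 = 0 then 8 * p + 3 else 4 * p + 1
    else if (i : ℕ) % 2 = 0 then 2 + 4 * (((i : ℕ) / 4 : ℕ) : ℤ) + (((i : ℕ) / 2 % 2 : ℕ) : ℤ)
    else 8 * p + 1 - 4 * (((i : ℕ) / 4 : ℕ) : ℤ) - (((i : ℕ) / 2 % 2 : ℕ) : ℤ)
  | .right j =>
    if (j : ℕ) / 4 = p then if (j : ℕ) % 2 = 0 then 8 * p + 4 else 4 * p + 2
    else if (j : ℕ) % 2 = 0 then 4 + 4 * (((j : ℕ) / 4 : ℕ) : ℤ) - 3 * (((j : ℕ) / 2 % 2 : ℕ) : ℤ)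
    else 8 * p - 1 - 4 * (((j : ℕ) / 4 : ℕ) : ℤ) + 3 * (((j : ℕ) / 2 % 2 : ℕ) : ℤ)

/-- The intervals spanned by the edges on the upper page for the piece `p`. -/
def StripUp (p l r : ℤ) : Prop :=
  r = l + 1 ∨
  (l = 0 ∧ (r = 2 ∧ 1 ≤ p ∨ r = 8 * p + 4)) ∨
  ((l % 4 = 2 ∨ l % 4 = 3) ∧ 2 ≤ l ∧ l ≤ 4 * p ∧ r = 8 * p + 4) ∨
  (l % 4 = 0 ∧ 2 ≤ l ∧ r = l + 2 ∧ r ≤ 4 * p) ∨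
  (l = 4 * p + 1 ∧ r = 8 * p + 4) ∨
  (l = 4 * p + 2 ∧ r = 8 * p + 3) ∨
  (((l - 4 * p) % 4 = 3 ∨ (l - 4 * p) % 4 = 2) ∧ 4 * p + 3 ≤ l ∧ l < 8 * p + 3 ∧ r = 8 * p + 3) ∨
  ((l - 4 * p) % 4 = 3 ∧ 4 * p + 3 ≤ l ∧ r = l + 2 ∧ r < 8 * p + 3)

/-- The intervals spanned by the edges on the lower page for the piece `p`. -/
def StripDown (p l r : ℤ) : Prop :=
  (l = 0 ∧ (r = 4 * p + 1 ∨ r = 4 * p + 2 ∨ r = 8 * p + 1 ∨ r = 8 * p + 3) ∧ 0 < r) ∨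
  ((l % 4 = 0 ∨ l % 4 = 1) ∧ 1 ≤ l ∧ l ≤ 4 * p ∧ r = 4 * p + 1) ∨
  (l % 4 = 2 ∧ 2 ≤ l ∧ r = l + 2 ∧ r ≤ 4 * p) ∨
  (l = 4 * p + 2 ∧ ((r - 4 * p) % 4 = 0 ∨ (r - 4 * p) % 4 = 1) ∧ 4 * p + 3 < r ∧ r < 8 * p + 3) ∨
  ((l - 4 * p) % 4 = 1 ∧ 4 * p + 3 ≤ l ∧ r = l + 2 ∧ r < 8 * p + 3)

theorem stripPos_injective (p : ℕ) : Function.Injective (stripPos p) := by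
  rintro (_ | ⟨i, hi⟩ | ⟨i, hi⟩) (_ | ⟨j, hj⟩ | ⟨j, hj⟩) h
  · rfl
  all_goals simp only [stripPos] at h
  case left.left | right.right =>
    obtain ⟨t, k, s, hk, hs, hi', e1, e2, e3, -⟩ := exists_block_side_rank i
    obtain ⟨t', k', s', hk', hs', hj', e1', e2', e3', -⟩ := exists_block_side_rank j
    rw [e1, e2, e3, e1', e2', e3'] at h
    congr 2
    split_ifs at h <;> omega
  all_goals exfalso
  case left.right | right.left =>
    obtain ⟨t, k, s, hk, hs, hi', e1, e2, e3, -⟩ := exists_block_side_rank i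
    obtain ⟨t', k', s', hk', hs', hj', e1', e2', e3', -⟩ := exists_block_side_rank j
    rw [e1, e2, e3, e1', e2', e3'] at h
    clear e1 e2 e3 e1' e2' e3'
    interval_cases k <;> interval_cases k' <;> split_ifs at h <;> omega
  all_goals split_ifs at h <;> omega

theorem stripUp_not_interleaving {p : ℤ} (hp : 0 ≤ p) (l r l' r' : ℤ) (h : StripUp p l r)
    (h' : StripUp p l' r') : ¬ (l < l' ∧ l' < r ∧ r < r') := by
  unfold StripUp at h h'
  rintro ⟨h1, h2, h3⟩
  rcases h with h | h | h | h | h | h | h | h <;>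
    rcases h' with h' | h' | h' | h' | h' | h' | h' | h' <;> omega

theorem stripDown_not_interleaving {p : ℤ} (hp : 0 ≤ p) (l r l' r' : ℤ) (h : StripDown p l r)
    (h' : StripDown p l' r') : ¬ (l < l' ∧ l' < r ∧ r < r') := by
  unfold StripDown at h h'
  rintro ⟨h1, h2, h3⟩
  rcases h with h | h | h | h | h <;> rcases h' with h' | h' | h' | h' | h' <;> omega

theorem isPlanar_piece_of_lt {p r : ℕ} (hr : r < p) :
    IsPlanar (SimpleGraph.fromRel (pieceRel p r)) := by
  refine isPlanar_fromRel_of_twoPage _ (blockPos p r) (blockPos_injective p r)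
    (BlockUp (4 * p + 2)) (BlockDown (4 * p + 2))
    (blockUp_not_interleaving (by omega)) (blockDown_not_interleaving (by omega))
    (fun l r h => by unfold BlockUp at h; omega) (fun l r h => by unfold BlockDown at h; omega) ?_
  rintro (_ | ⟨i, hi⟩ | ⟨i, hi⟩) (_ | ⟨j, hj⟩ | ⟨j, hj⟩) h
  case apex.left =>
    simp only [pieceRel, pieceL] at h
    generalize hy : blockPos p r (.left ⟨j, hj⟩) = y
    obtain ⟨t, k, s, hk, hs, hi', e1, e2, e3, e4⟩ := exists_block_side_rank j
    simp only [blockPos, e1, e2, e3, e4] at h hy ⊢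
    clear e1 e2 e3 e4
    interval_cases k <;> interval_cases s <;> split_ifs at h <;> try (exfalso; omega)
    all_goals split_ifs at hy <;> try (exfalso; omega)
    all_goals
    first
    | exact Or.inl (by unfold BlockUp; omega)
    | exact Or.inr (Or.inl (by unfold BlockUp; omega))
    | exact Or.inr (Or.inr (Or.inl (by unfold BlockDown; omega)))
  case apex.right =>
    simp only [pieceRel] at h
    generalize hy : blockPos p r (.right ⟨j, hj⟩) = y
    obtain ⟨t, k, s, hk, hs, hi', e1, e2, e3, e4⟩ := exists_block_side_rank j
    simp only [blockPos, e1, e2, e4] at h hy ⊢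
    clear e1 e2 e3 e4
    interval_cases k <;> interval_cases s <;> split_ifs at hy <;> try (exfalso; omega)
    all_goals
    first
    | exact Or.inl (by unfold BlockUp; omega)
    | exact Or.inr (Or.inr (Or.inl (by unfold BlockDown; omega)))
  case left.right =>
    simp only [pieceRel, pieceLR] at h
    generalize hx : blockPos p r (.left ⟨i, hi⟩) = x
    generalize hy : blockPos p r (.right ⟨j, hj⟩) = y
    obtain ⟨t, k, s, hk, hs, hi', e1, e2, e3, e4⟩ := exists_block_side_rank i
    obtain ⟨t', k', s', hk', hs', hj', e1', e2', e3', e4'⟩ := exists_block_side_rank j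
    simp only [blockPos, e1, e2, e3, e4, e1', e2', e3', e4'] at h hx hy ⊢
    clear e1 e2 e3 e4 e1' e2' e3' e4'
    interval_cases k <;> interval_cases s <;> interval_cases k' <;> interval_cases s' <;>
    simp only [not_true_eq_false, not_false_eq_true, and_true, and_false, or_true, or_false,
      Nat.reduceMul, Nat.reduceAdd, Nat.reduceEqDiff, ite_true, ite_false, ne_eq,
      reduceCtorEq, Nat.add_zero] at h hx hy
    all_goals split_ifs at h <;> try (exfalso; omega)
    all_goals split_ifs at hx <;> try (exfalso; omega)
    all_goals split_ifs at hy <;> try (exfalso; omega)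
    all_goals
    first
    | exact Or.inl (by unfold BlockUp; omega)
    | exact Or.inr (Or.inl (by unfold BlockUp; omega))
    | exact Or.inr (Or.inr (Or.inl (by unfold BlockDown; omega)))
    | exact Or.inr (Or.inr (Or.inr (by unfold BlockDown; omega)))
  all_goals exact h.elim

set_option maxHeartbeats 400000 in
theorem isPlanar_piece_self (p : ℕ) :
    IsPlanar (SimpleGraph.fromRel (pieceRel p p)) := by
  refine isPlanar_fromRel_of_twoPage _ (stripPos p) (stripPos_injective p)
    (StripUp p) (StripDown p)
    (stripUp_not_interleaving (by omega)) (stripDown_not_interleaving (by omega))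
    (fun l r h => by unfold StripUp at h; omega) (fun l r h => by unfold StripDown at h; omega) ?_
  rintro (_ | ⟨i, hi⟩ | ⟨i, hi⟩) (_ | ⟨j, hj⟩ | ⟨j, hj⟩) h
  case apex.left =>
    simp only [pieceRel, pieceL] at h
    generalize hy : stripPos p (.left ⟨j, hj⟩) = y
    obtain ⟨t, k, s, hk, hs, hi', e1, e2, e3, e4⟩ := exists_block_side_rank j
    simp only [stripPos, e1, e2, e3] at h hy ⊢
    clear e1 e2 e3 e4
    interval_cases k <;> interval_cases s <;> split_ifs at h <;> try (exfalso; omega)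
    all_goals split_ifs at hy <;> try (exfalso; omega)
    all_goals
    first
    | exact Or.inl (by unfold StripUp; omega)
    | exact Or.inr (Or.inr (Or.inl (by unfold StripDown; omega)))
  case apex.right =>
    simp only [pieceRel] at h
    generalize hy : stripPos p (.right ⟨j, hj⟩) = y
    obtain ⟨t, k, s, hk, hs, hi', e1, e2, e3, e4⟩ := exists_block_side_rank j
    simp only [stripPos, e1, e2, e3] at h hy ⊢
    clear e1 e2 e3 e4
    interval_cases k <;> interval_cases s <;> split_ifs at hy <;> try (exfalso; omega)
    all_goals
    first
    | exact Or.inl (by unfold StripUp; omega)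
    | exact Or.inr (Or.inr (Or.inl (by unfold StripDown; omega)))
  case left.right =>
    simp only [pieceRel, pieceLR] at h
    generalize hx : stripPos p (.left ⟨i, hi⟩) = x
    generalize hy : stripPos p (.right ⟨j, hj⟩) = y
    obtain ⟨t, k, s, hk, hs, hi', e1, e2, e3, e4⟩ := exists_block_side_rank i
    obtain ⟨t', k', s', hk', hs', hj', e1', e2', e3', e4'⟩ := exists_block_side_rank j
    simp only [stripPos, e1, e2, e3, e1', e2', e3'] at h hx hy ⊢
    clear e1 e2 e3 e4 e1' e2' e3' e4'
    interval_cases k <;> interval_cases s <;> interval_cases k' <;> interval_cases s' <;>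
    simp only [not_true_eq_false, not_false_eq_true, and_true, and_false, or_true, or_false,
      ite_true, ite_false, ne_eq, reduceCtorEq] at h hx hy
    all_goals split_ifs at h <;> try (exfalso; omega)
    all_goals split_ifs at hx <;> try (exfalso; omega)
    all_goals split_ifs at hy <;> try (exfalso; omega)
    -- The alternatives select a page and one of the disjuncts that describe it.
    all_goals
    unfold StripUp StripDown
    first
    | (refine .inl (.inl ?_); omega)
    | (refine .inl (.inr (.inr (.inl ?_))); omega)
    | (refine .inl (.inr (.inr (.inr (.inr (.inl ?_))))); omega)
    | (refine .inr (.inl (.inl ?_)); omega)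
    | (refine .inr (.inl (.inr (.inr (.inr (.inl ?_))))); omega)
    | (refine .inr (.inl (.inr (.inr (.inr (.inr (.inr (.inl ?_))))))); omega)
    | (refine .inr (.inl (.inr (.inr (.inr (.inr (.inr (.inr (.inl ?_)))))))); omega)
    | (refine .inr (.inl (.inr (.inr (.inr (.inr (.inr (.inr (.inr ?_)))))))); omega)
    | (refine .inr (.inr (.inl (.inl ?_))); omega)
    | (refine .inr (.inr (.inl (.inr (.inr (.inl ?_))))); omega)
    | (refine .inr (.inr (.inl (.inr (.inr (.inr (.inr ?_)))))); omega)
    | (refine .inr (.inr (.inr (.inl ?_))); omega)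
    | (refine .inr (.inr (.inr (.inr (.inl ?_)))); omega)
    | (refine .inr (.inr (.inr (.inr (.inr (.inr (.inl ?_)))))); omega)
  all_goals exact h.elim

/-- The vertices of `K_{1,n,n}` as vertices of `K_{1,N,N}` for `n ≤ N`. -/
def tripartiteVertex {n N : ℕ} (h : n ≤ N) :
    (Σ i : Fin 3, Fin ((![1, n, n] : Fin 3 → ℕ) i)) → TripartiteVertex N
  | ⟨0, _⟩ => .apex
  | ⟨1, i⟩ => .left ⟨i, lt_of_lt_of_le i.2 h⟩
  | ⟨2, j⟩ => .right ⟨j, lt_of_lt_of_le j.2 h⟩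

theorem tripartiteVertex_injective {n N : ℕ} (h : n ≤ N) :
    Function.Injective (tripartiteVertex h) := by
  rintro ⟨i, a⟩ ⟨j, b⟩ hab
  fin_cases i <;> fin_cases j <;> simp only [tripartiteVertex, reduceCtorEq] at hab
  · congr 1
    exact Subsingleton.elim (α := Fin 1) a b
  · simp only [TripartiteVertex.left.injEq, Fin.mk.injEq] at hab
    congr 1
    exact Fin.ext hab
  · simp only [TripartiteVertex.right.injEq, Fin.mk.injEq] at hab
    congr 1
    exact Fin.ext hab

theorem exists_piece {p : ℕ} : ∀ a b : TripartiteVertex (4 * p + 2),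
    (∀ i j, a = .left i → b ≠ .left j) → (∀ i j, a = .right i → b ≠ .right j) →
    a ≠ b → ∃ r < p + 1, (SimpleGraph.fromRel (pieceRel p r)).Adj a b := by
  have hL : ∀ i : Fin (4 * p + 2), pieceL p i < p + 1 := fun i => by
    unfold pieceL
    split_ifs <;> omega
  have hR : ∀ j : Fin (4 * p + 2), (j : ℕ) / 4 < p + 1 := fun j => by omega
  have hLR : ∀ i j : Fin (4 * p + 2), pieceLR p i j < p + 1 := fun i j => by
    unfold pieceLR
    split_ifs <;> omega
  simp only [SimpleGraph.fromRel_adj]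
  rintro (_ | i | i) (_ | j | j) h1 h2 hne
  · exact absurd rfl hne
  · exact ⟨_, hL j, hne, Or.inl rfl⟩
  · exact ⟨_, hR j, hne, Or.inl rfl⟩
  · exact ⟨_, hL i, hne, Or.inr rfl⟩
  · exact absurd rfl (h1 i j rfl)
  · exact ⟨_, hLR i j, hne, Or.inl rfl⟩
  · exact ⟨_, hR i, hne, Or.inr rfl⟩
  · exact ⟨_, hLR j i, hne, Or.inr rfl⟩
  · exact absurd rfl (h2 i j rfl)

theorem isUnionOfPlanarSubgraphs_completeTripartite {n p : ℕ} (h : n ≤ 4 * p + 2) :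
    IsUnionOfPlanarSubgraphs (completeTripartite 1 n n) (p + 1) := by
  refine isUnionOfPlanarSubgraphs_of_iSup p.succ_pos
    (fun r => (SimpleGraph.fromRel (pieceRel p r)).comap (tripartiteVertex h)) ?_ ?_
  · intro r hr
    refine IsPlanar.of_injective (G' := SimpleGraph.fromRel (pieceRel p r)) ?_
      (tripartiteVertex h) (tripartiteVertex_injective h) (fun a b hab => hab)
    rcases Nat.lt_succ_iff_lt_or_eq.1 hr with hr | rfl
    · exact isPlanar_piece_of_lt hr
    · exact isPlanar_piece_self r
  · intro a b hab
    refine exists_piece _ _ ?_ ?_ ((tripartiteVertex_injective h).ne hab.ne)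
    all_goals
      obtain ⟨i, a⟩ := a
      obtain ⟨j, b⟩ := b
      fin_cases i <;> fin_cases j <;> simp [tripartiteVertex] at hab ⊢

/-! ### Straight-line drawings and sweeping -/

/-- A plane straight-line drawing in general position: a finite set of points with distinct
abscissas, and segments `s`, with left end `a s` and right end `b s` among these points, which
contain no other of the points and meet in common ends only. -/
structure StraightDrawing (ι : Type*) where
  points : Finset (ℝ × ℝ)
  a : ι → ℝ × ℝ
  b : ι → ℝ × ℝ
  a_mem : ∀ s, a s ∈ points
  b_mem : ∀ s, b s ∈ points
  lt : ∀ s, (a s).1 < (b s).1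
  fst_inj : ∀ p ∈ points, ∀ q ∈ points, p.1 = q.1 → p = q
  eq_end_of_mem : ∀ q ∈ points, ∀ s, q ∈ segment ℝ (a s) (b s) → q = a s ∨ q = b s
  eq_ends_of_mem : ∀ s t, s ≠ t → ∀ z, z ∈ segment ℝ (a s) (b s) → z ∈ segment ℝ (a t) (b t) →
    (z = a s ∨ z = b s) ∧ (z = a t ∨ z = b t)

namespace StraightDrawing

variable {ι : Type*} (D : StraightDrawing ι)

/-- The height of the segment `s` above the abscissa `x`. -/
noncomputable def ht (s : ι) (x : ℝ) : ℝ := lineHeight (D.a s) (D.b s) x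

/-- The vertical line at `x` crosses the interior of the segment `s`. -/
def Over (x : ℝ) (s : ι) : Prop := (D.a s).1 < x ∧ x < (D.b s).1

/-- The segment `s` is present immediately to the left of the vertical line at `x`. -/
def LeftOf (x : ℝ) (s : ι) : Prop := (D.a s).1 < x ∧ x ≤ (D.b s).1

/-- The segment `s` is present immediately to the right of the vertical line at `x`. -/
def RightOf (x : ℝ) (s : ι) : Prop := (D.a s).1 ≤ x ∧ x < (D.b s).1

/-- The segment `s` runs below `t` somewhere, hence wherever both are present and do not meet. -/
def Below (s t : ι) : Prop :=
  ∃ x, ((D.a s).1 ≤ x ∧ x ≤ (D.b s).1) ∧ ((D.a t).1 ≤ x ∧ x ≤ (D.b t).1) ∧ D.ht s x < D.ht t x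

variable {D}

theorem ht_a (s : ι) : D.ht s (D.a s).1 = (D.a s).2 := lineHeight_left _ _

theorem ht_b (s : ι) : D.ht s (D.b s).1 = (D.b s).2 := lineHeight_right (D.lt s)

theorem mem_segment_iff (s : ι) (z : ℝ × ℝ) : z ∈ segment ℝ (D.a s) (D.b s) ↔
    (D.a s).1 ≤ z.1 ∧ z.1 ≤ (D.b s).1 ∧ z.2 = D.ht s z.1 :=
  mem_segment_iff_of_fst_lt (D.lt s) z

theorem continuous_ht (s : ι) : Continuous (D.ht s) := by
  unfold ht lineHeight
  fun_prop

theorem ht_ne {s t : ι} (hne : s ≠ t) {x : ℝ} (hs : D.Over x s) (ht : D.Over x t) :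
    D.ht s x ≠ D.ht t x := by
  intro h
  have h1 := D.eq_ends_of_mem s t hne (x, D.ht s x)
    ((mem_segment_iff s _).2 ⟨hs.1.le, hs.2.le, rfl⟩)
    ((mem_segment_iff t _).2 ⟨ht.1.le, ht.2.le, h⟩)
  rcases h1.1 with h1 | h1
  · exact hs.1.ne (congrArg Prod.fst h1).symm
  · exact hs.2.ne (congrArg Prod.fst h1)

theorem ht_le_of_lt {s t : ι} {x y : ℝ} (hsx : (D.a s).1 ≤ x ∧ x ≤ (D.b s).1)
    (htx : (D.a t).1 ≤ x ∧ x ≤ (D.b t).1) (hsy : (D.a s).1 ≤ y ∧ y ≤ (D.b s).1)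
    (hty : (D.a t).1 ≤ y ∧ y ≤ (D.b t).1) (h : D.ht s x < D.ht t x) : D.ht s y ≤ D.ht t y := by
  by_contra hcon
  push Not at hcon
  have hne : s ≠ t := by
    rintro rfl
    exact h.false
  have hc : ContinuousOn (fun x => D.ht t x - D.ht s x) (Set.uIcc x y) :=
    ((continuous_ht t).sub (continuous_ht s)).continuousOn
  obtain ⟨z, hz, hz0⟩ := intermediate_value_uIcc hc
    (show (0 : ℝ) ∈ _ from Set.mem_uIcc.2 (Or.inr ⟨by linarith, by linarith⟩))
  simp only at hz0
  have hzx : z ≠ x := by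
    rintro rfl
    linarith
  have hzy : z ≠ y := by
    rintro rfl
    linarith
  have : (x < z ∧ z < y) ∨ (y < z ∧ z < x) := by
    rcases Set.mem_uIcc.1 hz with h | h
    · exact Or.inl ⟨lt_of_le_of_ne h.1 hzx.symm, lt_of_le_of_ne h.2 hzy⟩
    · exact Or.inr ⟨lt_of_le_of_ne h.1 hzy.symm, lt_of_le_of_ne h.2 hzx⟩
  refine ht_ne hne (x := z) ?_ ?_ (by linarith)
  · rcases this with h | h
    · exact ⟨by linarith, by linarith⟩
    · exact ⟨by linarith, by linarith⟩
  · rcases this with h | h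
    · exact ⟨by linarith, by linarith⟩
    · exact ⟨by linarith, by linarith⟩

theorem Below.asymm {s t : ι} (h : D.Below s t) : ¬ D.Below t s := by
  rintro ⟨y, hy1, hy2, hy⟩
  obtain ⟨x, hx1, hx2, hx⟩ := h
  exact hy.not_ge (ht_le_of_lt hx1 hx2 hy2 hy1 hx)

theorem Below.ne {s t : ι} (h : D.Below s t) : s ≠ t := by
  rintro rfl
  exact h.asymm h

theorem Below.ht_le {s t : ι} (h : D.Below s t) {y : ℝ} (hsy : (D.a s).1 ≤ y ∧ y ≤ (D.b s).1)
    (hty : (D.a t).1 ≤ y ∧ y ≤ (D.b t).1) : D.ht s y ≤ D.ht t y := by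
  obtain ⟨x, hx1, hx2, hx⟩ := h
  exact ht_le_of_lt hx1 hx2 hsy hty hx

theorem below_total {s t : ι} (hne : s ≠ t) {x : ℝ} (hs : D.Over x s) (ht : D.Over x t) :
    D.Below s t ∨ D.Below t s := by
  rcases lt_or_gt_of_ne (ht_ne hne hs ht) with h | h
  · exact Or.inl ⟨x, ⟨hs.1.le, hs.2.le⟩, ⟨ht.1.le, ht.2.le⟩, h⟩
  · exact Or.inr ⟨x, ⟨ht.1.le, ht.2.le⟩, ⟨hs.1.le, hs.2.le⟩, h⟩

theorem exists_over_of_leftOf [Finite ι] (x : ℝ) : ∃ y, ∀ s, D.LeftOf x s → D.Over y s := by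
  obtain ⟨m, hm, hmx⟩ : ∃ m, (∀ s, (D.a s).1 < x → (D.a s).1 ≤ m) ∧ m < x := by
    by_cases hne : ∃ s, (D.a s).1 < x
    · obtain ⟨s, hs, hmax⟩ := Set.exists_max_image {s | (D.a s).1 < x} (fun s => (D.a s).1)
        (Set.toFinite _) hne
      exact ⟨_, hmax, hs⟩
    · exact ⟨x - 1, fun s hs => absurd ⟨s, hs⟩ hne, by linarith⟩
  refine ⟨(m + x) / 2, fun s hs => ⟨?_, ?_⟩⟩
  · linarith [hm s hs.1]
  · linarith [hs.2]

theorem exists_over_of_rightOf [Finite ι] (x : ℝ) : ∃ y, ∀ s, D.RightOf x s → D.Over y s := by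
  obtain ⟨m, hm, hmx⟩ : ∃ m, (∀ s, x < (D.b s).1 → m ≤ (D.b s).1) ∧ x < m := by
    by_cases hne : ∃ s, x < (D.b s).1
    · obtain ⟨s, hs, hmin⟩ := Set.exists_min_image {s | x < (D.b s).1} (fun s => (D.b s).1)
        (Set.toFinite _) hne
      exact ⟨_, hmin, hs⟩
    · exact ⟨x + 1, fun s hs => absurd ⟨s, hs⟩ hne, by linarith⟩
  refine ⟨(m + x) / 2, fun s hs => ⟨?_, ?_⟩⟩
  · linarith [hs.1]
  · linarith [hm s hs.2]

theorem exists_highest [Finite ι] {T : ι → Prop} (hne : ∃ s, T s)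
    (hT : ∃ x, ∀ s, T s → D.Over x s) : ∃ s, T s ∧ ∀ t, T t → t ≠ s → D.Below t s := by
  obtain ⟨x, hx⟩ := hT
  obtain ⟨s, hs, hmax⟩ := Set.exists_max_image {s | T s} (fun s => D.ht s x) (Set.toFinite _) hne
  refine ⟨s, hs, fun t ht hts => ?_⟩
  exact ⟨x, ⟨(hx t ht).1.le, (hx t ht).2.le⟩, ⟨(hx s hs).1.le, (hx s hs).2.le⟩,
    lt_of_le_of_ne (hmax t ht) (ht_ne hts (hx t ht) (hx s hs))⟩

theorem exists_lowest [Finite ι] {T : ι → Prop} (hne : ∃ s, T s)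
    (hT : ∃ x, ∀ s, T s → D.Over x s) : ∃ s, T s ∧ ∀ t, T t → t ≠ s → D.Below s t := by
  obtain ⟨x, hx⟩ := hT
  obtain ⟨s, hs, hmin⟩ := Set.exists_min_image {s | T s} (fun s => D.ht s x) (Set.toFinite _) hne
  refine ⟨s, hs, fun t ht hts => ?_⟩
  exact ⟨x, ⟨(hx s hs).1.le, (hx s hs).2.le⟩, ⟨(hx t ht).1.le, (hx t ht).2.le⟩,
    lt_of_le_of_ne (hmin t ht) (ht_ne hts (hx t ht) (hx s hs)).symm⟩

variable (D) in
/-- `D.IsTop T o`: the segment `o` is the highest one in `T`, or `T` is empty and `o = none`. -/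
def IsTop (T : ι → Prop) : Option ι → Prop
  | none => ∀ t, ¬ T t
  | some s => T s ∧ ∀ t, T t → t ≠ s → D.Below t s

open Classical in
variable (D) in
/-- The highest segment in `T`, or `none` if `T` is empty (or has no highest element). -/
noncomputable def top (T : ι → Prop) : Option ι :=
  if h : ∃ o, D.IsTop T o then h.choose else none

theorem top_eq_of_isTop {T : ι → Prop} {o : Option ι} (h : D.IsTop T o) : D.top T = o := by
  have hex : ∃ o, D.IsTop T o := ⟨o, h⟩
  unfold top
  rw [dif_pos hex]
  have h' := hex.choose_spec
  generalize hex.choose = o' at h'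
  match o, o', h, h' with
  | none, none, _, _ => rfl
  | none, some s, h, h' => exact absurd h'.1 (h s)
  | some s, none, h, h' => exact absurd h.1 (h' s)
  | some s, some s', h, h' =>
    by_contra hne
    have hne : s ≠ s' := fun e => hne (by rw [e])
    exact (h'.2 s h.1 hne).asymm (h.2 s' h'.1 hne.symm)

theorem top_eq_none {T : ι → Prop} (h : ∀ t, ¬ T t) : D.top T = none :=
  top_eq_of_isTop (o := none) h

theorem top_eq_some {T : ι → Prop} {s : ι} (hs : T s) (h : ∀ t, T t → t ≠ s → D.Below t s) :
    D.top T = some s :=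
  top_eq_of_isTop (o := some s) ⟨hs, h⟩

theorem top_congr {T T' : ι → Prop} (h : ∀ t, T t ↔ T' t) : D.top T = D.top T' := by
  rw [show T = T' from funext fun t => propext (h t)]

variable (D) in
/-- The segments that arrive at the point `w` from the left, or pass below it: the highest of them
bounds from below the region that touches the vertical line through `w` just above `w` from
the left. -/
def UnderLeft (w : ℝ × ℝ) (t : ι) : Prop := D.LeftOf w.1 t ∧ D.ht t w.1 ≤ w.2

variable (D) in
/-- The segments that leave the point `w` to the right, or pass below it. -/
def UnderRight (w : ℝ × ℝ) (t : ι) : Prop := D.RightOf w.1 t ∧ D.ht t w.1 ≤ w.2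

variable (D) in
/-- The region directly above a segment is named after this segment, and the region below all
segments is named `none`. A map `f` of names is compatible at `w` if it identifies the two names,
from the left and from the right of `w`, of the region directly above `w`. -/
def Compatible {α : Type*} (f : Option ι → α) (w : ℝ × ℝ) : Prop :=
  f (D.top (D.UnderLeft w)) = f (D.top (D.UnderRight w))

theorem b_eq_of_leftOf {w : ℝ × ℝ} (hw : w ∈ D.points) {t : ι} (h : D.LeftOf w.1 t)
    (hh : D.ht t w.1 = w.2) : D.b t = w := by
  rcases D.eq_end_of_mem w hw t ((mem_segment_iff t w).2 ⟨h.1.le, h.2, hh.symm⟩) with e | e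
  · exact absurd (congrArg Prod.fst e) h.1.ne'
  · exact e.symm

theorem a_eq_of_rightOf {w : ℝ × ℝ} (hw : w ∈ D.points) {t : ι} (h : D.RightOf w.1 t)
    (hh : D.ht t w.1 = w.2) : D.a t = w := by
  rcases D.eq_end_of_mem w hw t ((mem_segment_iff t w).2 ⟨h.1, h.2.le, hh.symm⟩) with e | e
  · exact e.symm
  · exact absurd (congrArg Prod.fst e) h.2.ne

theorem b_eq_of_fst {w : ℝ × ℝ} (hw : w ∈ D.points) {t : ι} (h : (D.b t).1 = w.1) : D.b t = w :=
  D.fst_inj _ (D.b_mem t) _ hw h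

theorem a_eq_of_fst {w : ℝ × ℝ} (hw : w ∈ D.points) {t : ι} (h : (D.a t).1 = w.1) : D.a t = w :=
  D.fst_inj _ (D.a_mem t) _ hw h

theorem ht_of_b_eq {w : ℝ × ℝ} {t : ι} (h : D.b t = w) : D.ht t w.1 = w.2 := by
  rw [← h, ht_b]

theorem ht_of_a_eq {w : ℝ × ℝ} {t : ι} (h : D.a t = w) : D.ht t w.1 = w.2 := by
  rw [← h, ht_a]

theorem leftOf_of_b_eq {w : ℝ × ℝ} {t : ι} (h : D.b t = w) : D.LeftOf w.1 t := by
  rw [← h]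
  exact ⟨D.lt t, le_rfl⟩

theorem rightOf_of_a_eq {w : ℝ × ℝ} {t : ι} (h : D.a t = w) : D.RightOf w.1 t := by
  rw [← h]
  exact ⟨le_rfl, D.lt t⟩

/-- The region directly below a curve does not change when the curve passes a point `w`. The
curve is given by the set `Q` of the segments below it. -/
theorem top_leftOf_eq_top_rightOf [Finite ι] {α : Type*} {f : Option ι → α} {w : ℝ × ℝ}
    (hw : w ∈ D.points) (hf : D.Compatible f w) (Q : ι → Prop)
    (hQ : (∀ t, D.b t = w ∨ D.a t = w → ¬ Q t) ∨
      (∀ t, (D.a t).1 ≤ w.1 → w.1 ≤ (D.b t).1 → D.ht t w.1 ≤ w.2 → Q t)) :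
    f (D.top fun t => D.LeftOf w.1 t ∧ Q t) = f (D.top fun t => D.RightOf w.1 t ∧ Q t) := by
  rcases hQ with hQ | hQ
  · congr 1
    apply top_congr
    intro t
    constructor
    · rintro ⟨h, hq⟩
      refine ⟨⟨h.1.le, lt_of_le_of_ne h.2 fun e => ?_⟩, hq⟩
      exact hQ t (Or.inl (b_eq_of_fst hw e.symm)) hq
    · rintro ⟨h, hq⟩
      refine ⟨⟨lt_of_le_of_ne h.1 fun e => ?_, h.2.le⟩, hq⟩
      exact hQ t (Or.inr (a_eq_of_fst hw e)) hq
  · by_cases hT : ∃ t, D.Over w.1 t ∧ Q t ∧ w.2 < D.ht t w.1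
    · -- Some segment separates `w` from the curve.
      obtain ⟨s, ⟨hs, hq, hlt⟩, hmax⟩ := exists_highest hT ⟨w.1, fun s h => h.1⟩
      rw [top_eq_some (D := D) (s := s) (T := fun t => D.LeftOf w.1 t ∧ Q t) ⟨⟨hs.1, hs.2.le⟩, hq⟩,
        top_eq_some (D := D) (s := s) (T := fun t => D.RightOf w.1 t ∧ Q t) ⟨⟨hs.1.le, hs.2⟩, hq⟩]
      · rintro t ⟨ht, htq⟩ hne
        rcases le_or_gt (D.ht t w.1) w.2 with h | h
        · exact ⟨w.1, ⟨ht.1, ht.2.le⟩, ⟨hs.1.le, hs.2.le⟩, h.trans_lt hlt⟩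
        · refine hmax t ⟨⟨lt_of_le_of_ne ht.1 fun e => ?_, ht.2⟩, htq, h⟩ hne
          exact h.ne' (ht_of_a_eq (a_eq_of_fst hw e))
      · rintro t ⟨ht, htq⟩ hne
        rcases le_or_gt (D.ht t w.1) w.2 with h | h
        · exact ⟨w.1, ⟨ht.1.le, ht.2⟩, ⟨hs.1.le, hs.2.le⟩, h.trans_lt hlt⟩
        · refine hmax t ⟨⟨ht.1, lt_of_le_of_ne ht.2 fun e => ?_⟩, htq, h⟩ hne
          exact h.ne' (ht_of_b_eq (b_eq_of_fst hw e.symm))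
    · push Not at hT
      have e1 : D.top (fun t => D.LeftOf w.1 t ∧ Q t) = D.top (D.UnderLeft w) := by
        apply top_congr
        intro t
        refine ⟨fun ⟨h, hq⟩ => ⟨h, ?_⟩, fun h => ⟨h.1, hQ t h.1.1.le h.1.2 h.2⟩⟩
        rcases h.2.lt_or_eq with h2 | h2
        · exact hT t ⟨h.1, h2⟩ hq
        · exact (ht_of_b_eq (b_eq_of_fst hw h2.symm)).le
      have e2 : D.top (fun t => D.RightOf w.1 t ∧ Q t) = D.top (D.UnderRight w) := by
        apply top_congr
        intro t
        refine ⟨fun ⟨h, hq⟩ => ⟨h, ?_⟩, fun h => ⟨h.1, hQ t h.1.1 h.1.2.le h.2⟩⟩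
        rcases h.1.lt_or_eq with h2 | h2
        · exact hT t ⟨h2, h.2⟩ hq
        · exact (ht_of_a_eq (a_eq_of_fst hw h2)).le
      rw [e1, e2]
      exact hf

/-- The region directly below a curve is the same all along the curve. -/
theorem top_rightOf_eq_top_leftOf [Finite ι] {α : Type*} {f : Option ι → α} (Q : ι → Prop)
    {x y : ℝ} (hxy : x < y)
    (hf : ∀ w ∈ D.points, x < w.1 → w.1 < y → D.Compatible f w ∧
      ((∀ t, D.b t = w ∨ D.a t = w → ¬ Q t) ∨
        (∀ t, (D.a t).1 ≤ w.1 → w.1 ≤ (D.b t).1 → D.ht t w.1 ≤ w.2 → Q t))) :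
    f (D.top fun t => D.RightOf x t ∧ Q t) = f (D.top fun t => D.LeftOf y t ∧ Q t) := by
  classical
  induction hn : (D.points.filter fun w => x < w.1 ∧ w.1 < y).card using Nat.strong_induction_on
    generalizing x y with
  | _ n ih =>
    by_cases hw : ∃ w ∈ D.points, x < w.1 ∧ w.1 < y
    · obtain ⟨w, hw, h1, h2⟩ := hw
      have c1 : (D.points.filter fun v => x < v.1 ∧ v.1 < w.1).card < n := by
        rw [← hn]
        apply Finset.card_lt_card
        refine (Finset.ssubset_iff_of_subset ?_).2 ⟨w, by simp [hw, h1, h2], by simp⟩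
        intro v
        simp only [Finset.mem_filter]
        exact fun h => ⟨h.1, h.2.1, h.2.2.trans h2⟩
      have c2 : (D.points.filter fun v => w.1 < v.1 ∧ v.1 < y).card < n := by
        rw [← hn]
        apply Finset.card_lt_card
        refine (Finset.ssubset_iff_of_subset ?_).2 ⟨w, by simp [hw, h1, h2], by simp⟩
        intro v
        simp only [Finset.mem_filter]
        exact fun h => ⟨h.1, h1.trans h.2.1, h.2.2⟩
      rw [ih _ c1 h1 (fun v hv hv1 hv2 => hf v hv hv1 (hv2.trans h2)) rfl,
        top_leftOf_eq_top_rightOf hw (hf w hw h1 h2).1 Q (hf w hw h1 h2).2,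
        ih _ c2 h2 (fun v hv hv1 hv2 => hf v hv (h1.trans hv1) hv2) rfl]
    · push Not at hw
      congr 1
      apply top_congr
      intro t
      refine and_congr_left fun _ => ⟨fun h => ⟨h.1.trans_lt hxy, hw _ (D.b_mem t) h.2⟩,
        fun h => ⟨?_, hxy.trans_le h.2⟩⟩
      by_contra hcon
      exact (hw _ (D.a_mem t) (not_le.1 hcon)).not_gt h.1

/-- The name of the region directly below the segment `s`. -/
noncomputable def belowName (D : StraightDrawing ι) (s : ι) : Option ι :=
  D.top fun t => D.RightOf (D.a s).1 t ∧ D.Below t s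

theorem apply_belowName_eq [Finite ι] {α : Type*} {f : Option ι → α}
    (hf : ∀ w ∈ D.points, D.Compatible f w) (s : ι) :
    f (D.belowName s) = f (D.top fun t => D.LeftOf (D.b s).1 t ∧ D.Below t s) := by
  refine top_rightOf_eq_top_leftOf _ (D.lt s) fun w hw h1 h2 => ⟨hf w hw, ?_⟩
  have hne : D.ht s w.1 ≠ w.2 := by
    intro h
    have := b_eq_of_leftOf hw ⟨h1, h2.le⟩ h
    rw [this] at h2
    exact h2.false
  rcases lt_or_gt_of_ne hne with h | h
  · left
    rintro t (rfl | rfl)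
    · exact Below.asymm ⟨_, ⟨h1.le, h2.le⟩, ⟨(D.lt t).le, le_rfl⟩, by rwa [ht_b]⟩
    · exact Below.asymm ⟨_, ⟨h1.le, h2.le⟩, ⟨le_rfl, (D.lt t).le⟩, by rwa [ht_a]⟩
  · right
    intro t ht1 ht2 ht3
    exact ⟨w.1, ⟨ht1, ht2⟩, ⟨h1.le, h2.le⟩, ht3.trans_lt h⟩

theorem top_underLeft_eq_none {w : ℝ × ℝ} (h : ∀ t, w.1 ≤ (D.a t).1) :
    D.top (D.UnderLeft w) = none :=
  top_eq_none fun t ht => (h t).not_gt ht.1.1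

/-- Compatibility at the leftmost point is automatic, as the region above all segments and the
region below all segments are connected both on the left and on the right of the drawing.
This is the redundancy that gives Euler's formula its constant term. -/
theorem compatible_leftmost [Finite ι] {α : Type*} {f : Option ι → α} {w₀ : ℝ × ℝ}
    (hw₀ : w₀ ∈ D.points) (hmin : ∀ w ∈ D.points, w₀.1 ≤ w.1)
    (hf : ∀ w ∈ D.points, w ≠ w₀ → D.Compatible f w) : D.Compatible f w₀ := by
  obtain ⟨q, hq, hmax⟩ := D.points.exists_max_image Prod.fst ⟨w₀, hw₀⟩
  have key := top_rightOf_eq_top_leftOf (D := D) (f := f) (fun _ => True) (x := w₀.1)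
    (y := q.1 + 1) (by linarith [hmin q hq]) fun w hw h _ =>
      ⟨hf w hw (fun e => by rw [e] at h; exact h.false), Or.inr fun _ _ _ _ => trivial⟩
  have e1 : D.top (fun t => D.LeftOf (q.1 + 1) t ∧ True) = none :=
    top_eq_none fun t ht => by
      have := hmax _ (D.b_mem t)
      linarith [ht.1.2]
  have e2 : D.top (fun t => D.RightOf w₀.1 t ∧ True) = D.top (D.UnderRight w₀) := by
    apply top_congr
    intro t
    refine and_congr_right fun h => ⟨fun _ => ?_, fun _ => trivial⟩
    exact (ht_of_a_eq (a_eq_of_fst hw₀ (le_antisymm h.1 (hmin _ (D.a_mem t))))).le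
  rw [e1, e2] at key
  unfold Compatible
  rw [top_underLeft_eq_none fun t => hmin _ (D.a_mem t), key]

/-- Identifying the members of each of `k` pairs lowers the number of classes by at most `k`. -/
theorem exists_merge {α β : Type*} [Fintype α] [DecidableEq α] [DecidableEq β]
    (P : Finset β) (l r : β → α) :
    ∃ f : α → α, (∀ w ∈ P, f (l w) = f (r w)) ∧
      Fintype.card α ≤ (Finset.univ.image f).card + P.card := by
  induction P using Finset.induction_on with
  | empty => exact ⟨id, by simp, by simp⟩
  | insert w P hw ih =>
    obtain ⟨f, hf, hcard⟩ := ih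
    refine ⟨fun z => if f z = f (r w) then f (l w) else f z, ?_, ?_⟩
    · intro v hv
      rcases Finset.mem_insert.1 hv with rfl | hv
      · by_cases h : f (l v) = f (r v) <;> simp [h]
      · simp only [hf v hv]
    · rw [Finset.card_insert_of_notMem hw]
      have : (Finset.univ.image f).erase (f (r w)) ⊆
          Finset.univ.image fun z => if f z = f (r w) then f (l w) else f z := by
        intro y hy
        obtain ⟨hne, hy⟩ := Finset.mem_erase.1 hy
        obtain ⟨z, -, rfl⟩ := Finset.mem_image.1 hy
        exact Finset.mem_image.2 ⟨z, Finset.mem_univ _, if_neg hne⟩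
      have h1 := Finset.card_le_card this
      have h2 := Finset.pred_card_le_card_erase (s := Finset.univ.image f) (a := f (r w))
      omega

/-- The counting part of Euler's formula: there are at least `E - V + 2` regions. -/
theorem exists_compatible [Fintype ι] [DecidableEq ι] (D : StraightDrawing ι)
    (hne : D.points.Nonempty) :
    ∃ f : Option ι → Option ι, (∀ w ∈ D.points, D.Compatible f w) ∧
      Fintype.card ι + 2 ≤ (Finset.univ.image f).card + D.points.card := by
  obtain ⟨w₀, hw₀, hmin⟩ := D.points.exists_min_image Prod.fst hne
  obtain ⟨f, hf, hcard⟩ := exists_merge (D.points.erase w₀) (fun w => D.top (D.UnderLeft w))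
    (fun w => D.top (D.UnderRight w))
  have hf' : ∀ w ∈ D.points, w ≠ w₀ → D.Compatible f w := fun w hw hne =>
    hf w (Finset.mem_erase.2 ⟨hne, hw⟩)
  refine ⟨f, fun w hw => ?_, ?_⟩
  · by_cases h : w = w₀
    · rw [h]
      exact compatible_leftmost hw₀ hmin hf'
    · exact hf' w hw h
  · rw [Finset.card_erase_of_mem hw₀, Fintype.card_option] at hcard
    have := Finset.card_pos.2 hne
    omega

end StraightDrawing

namespace StraightDrawing

variable {ι : Type*} {D : StraightDrawing ι}

/-! ### Walking around a region -/

/-- The starting point of the segment `d.1` directed to the right (`d.2 = true`) or to the left. -/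
def tail (D : StraightDrawing ι) (d : ι × Bool) : ℝ × ℝ := if d.2 then D.a d.1 else D.b d.1

/-- The end point of the segment `d.1` directed to the right (`d.2 = true`) or to the left. -/
def head (D : StraightDrawing ι) (d : ι × Bool) : ℝ × ℝ := if d.2 then D.b d.1 else D.a d.1

/-- The name of the region on the left-hand side of a directed segment. -/
noncomputable def leftName (D : StraightDrawing ι) (d : ι × Bool) : Option ι :=
  if d.2 then some d.1 else D.belowName d.1

/-- The segment `t` passes below the point `w`. -/
def PassesUnder (D : StraightDrawing ι) (w : ℝ × ℝ) (t : ι) : Prop :=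
  D.Over w.1 t ∧ D.ht t w.1 < w.2

theorem leftOf_below_iff_passesUnder {w : ℝ × ℝ} (hw : w ∈ D.points) {s : ι} (hs : D.b s = w)
    (hlow : ∀ t, D.b t = w → t ≠ s → D.Below s t) (t : ι) :
    D.LeftOf w.1 t ∧ D.Below t s ↔ D.PassesUnder w t := by
  have hs' := leftOf_of_b_eq hs
  constructor
  · rintro ⟨h1, h2⟩
    have hle : D.ht t w.1 ≤ w.2 := by
      rw [← ht_of_b_eq hs]
      exact h2.ht_le ⟨h1.1.le, h1.2⟩ ⟨hs'.1.le, hs'.2⟩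
    have hlt : D.ht t w.1 < w.2 := lt_of_le_of_ne hle fun e =>
      h2.asymm (hlow t (b_eq_of_leftOf hw h1 e) h2.ne)
    refine ⟨⟨h1.1, lt_of_le_of_ne h1.2 fun e => hlt.ne (ht_of_b_eq (b_eq_of_fst hw e.symm))⟩, hlt⟩
  · rintro ⟨h1, h2⟩
    exact ⟨⟨h1.1, h1.2.le⟩, w.1, ⟨h1.1.le, h1.2.le⟩, ⟨hs'.1.le, hs'.2⟩, by rwa [ht_of_b_eq hs]⟩

theorem rightOf_below_iff_passesUnder {w : ℝ × ℝ} (hw : w ∈ D.points) {s : ι} (hs : D.a s = w)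
    (hlow : ∀ t, D.a t = w → t ≠ s → D.Below s t) (t : ι) :
    D.RightOf w.1 t ∧ D.Below t s ↔ D.PassesUnder w t := by
  have hs' := rightOf_of_a_eq hs
  constructor
  · rintro ⟨h1, h2⟩
    have hle : D.ht t w.1 ≤ w.2 := by
      rw [← ht_of_a_eq hs]
      exact h2.ht_le ⟨h1.1, h1.2.le⟩ ⟨hs'.1, hs'.2.le⟩
    have hlt : D.ht t w.1 < w.2 := lt_of_le_of_ne hle fun e =>
      h2.asymm (hlow t (a_eq_of_rightOf hw h1 e) h2.ne)
    refine ⟨⟨lt_of_le_of_ne h1.1 fun e => hlt.ne (ht_of_a_eq (a_eq_of_fst hw e)), h1.2⟩, hlt⟩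
  · rintro ⟨h1, h2⟩
    exact ⟨⟨h1.1.le, h1.2⟩, w.1, ⟨h1.1.le, h1.2.le⟩, ⟨hs'.1, hs'.2.le⟩, by rwa [ht_of_a_eq hs]⟩

theorem underLeft_iff_passesUnder {w : ℝ × ℝ} (hw : w ∈ D.points) (hno : ∀ t, D.b t ≠ w) (t : ι) :
    D.UnderLeft w t ↔ D.PassesUnder w t := by
  constructor
  · rintro ⟨h1, h2⟩
    exact ⟨⟨h1.1, lt_of_le_of_ne h1.2 fun e => hno t (b_eq_of_fst hw e.symm)⟩,
      lt_of_le_of_ne h2 fun e => hno t (b_eq_of_leftOf hw h1 e)⟩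
  · rintro ⟨h1, h2⟩
    exact ⟨⟨h1.1, h1.2.le⟩, h2.le⟩

theorem underRight_iff_passesUnder {w : ℝ × ℝ} (hw : w ∈ D.points) (hno : ∀ t, D.a t ≠ w) (t : ι) :
    D.UnderRight w t ↔ D.PassesUnder w t := by
  constructor
  · rintro ⟨h1, h2⟩
    exact ⟨⟨lt_of_le_of_ne h1.1 fun e => hno t (a_eq_of_fst hw e), h1.2⟩,
      lt_of_le_of_ne h2 fun e => hno t (a_eq_of_rightOf hw h1 e)⟩
  · rintro ⟨h1, h2⟩
    exact ⟨⟨h1.1.le, h1.2⟩, h2.le⟩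

theorem top_underLeft_eq_some {w : ℝ × ℝ} (hw : w ∈ D.points) {s : ι} (hs : D.b s = w)
    (hhigh : ∀ t, D.b t = w → t ≠ s → D.Below t s) : D.top (D.UnderLeft w) = some s := by
  have hs' := leftOf_of_b_eq hs
  refine top_eq_some ⟨hs', (ht_of_b_eq hs).le⟩ fun t ht hne => ?_
  rcases ht.2.lt_or_eq with h | h
  · exact ⟨w.1, ⟨ht.1.1.le, ht.1.2⟩, ⟨hs'.1.le, hs'.2⟩, by rwa [ht_of_b_eq hs]⟩
  · exact hhigh t (b_eq_of_leftOf hw ht.1 h) hne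

theorem top_underRight_eq_some {w : ℝ × ℝ} (hw : w ∈ D.points) {s : ι} (hs : D.a s = w)
    (hhigh : ∀ t, D.a t = w → t ≠ s → D.Below t s) : D.top (D.UnderRight w) = some s := by
  have hs' := rightOf_of_a_eq hs
  refine top_eq_some ⟨hs', (ht_of_a_eq hs).le⟩ fun t ht hne => ?_
  rcases ht.2.lt_or_eq with h | h
  · exact ⟨w.1, ⟨ht.1.1, ht.1.2.le⟩, ⟨hs'.1, hs'.2.le⟩, by rwa [ht_of_a_eq hs]⟩
  · exact hhigh t (a_eq_of_rightOf hw ht.1 h) hne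

theorem exists_over_of_b_eq [Finite ι] (D : StraightDrawing ι) (w : ℝ × ℝ) :
    ∃ y, ∀ s, D.b s = w → D.Over y s := by
  obtain ⟨y, hy⟩ := exists_over_of_leftOf (D := D) w.1
  exact ⟨y, fun s hs => hy s (leftOf_of_b_eq hs)⟩

theorem exists_over_of_a_eq [Finite ι] (D : StraightDrawing ι) (w : ℝ × ℝ) :
    ∃ y, ∀ s, D.a s = w → D.Over y s := by
  obtain ⟨y, hy⟩ := exists_over_of_rightOf (D := D) w.1
  exact ⟨y, fun s hs => hy s (rightOf_of_a_eq hs)⟩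

/-- The segment that continues the walk around the region on the left of a segment arriving at `w`
from the left. -/
theorem exists_next_of_b_eq [Finite ι] {α : Type*} {f : Option ι → α}
    (hf : ∀ w ∈ D.points, D.Compatible f w) {w : ℝ × ℝ} (hw : w ∈ D.points) {s : ι}
    (hs : D.b s = w) (hother : ∃ t, t ≠ s ∧ (D.a t = w ∨ D.b t = w)) :
    ∃ d : ι × Bool, d.1 ≠ s ∧ D.tail d = w ∧ f (D.leftName d) = f (some s) := by
  have hs' := leftOf_of_b_eq hs
  obtain ⟨x, hx⟩ := exists_over_of_leftOf (D := D) w.1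
  obtain ⟨y, hy⟩ := D.exists_over_of_a_eq w
  by_cases hA : ∃ t, D.b t = w ∧ D.Below s t
  · -- Turn back along the next higher segment on the left.
    obtain ⟨s', ⟨h1, h2⟩, hlow⟩ := exists_lowest hA ⟨x, fun t h => hx t (leftOf_of_b_eq h.1)⟩
    refine ⟨(s', false), h2.ne.symm, h1, ?_⟩
    change f (D.belowName s') = _
    rw [apply_belowName_eq hf, h1]
    congr 1
    refine top_eq_some ⟨hs', h2⟩ fun t ht hne => ?_
    rcases below_total hne (hx t ht.1) (hx s hs') with h | h
    · exact h
    exfalso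
    have e1 := h.ht_le ⟨hs'.1.le, hs'.2⟩ ⟨ht.1.1.le, ht.1.2⟩
    have hs1 := leftOf_of_b_eq h1
    have e2 := ht.2.ht_le ⟨ht.1.1.le, ht.1.2⟩ ⟨hs1.1.le, hs1.2⟩
    rw [ht_of_b_eq hs] at e1
    rw [ht_of_b_eq h1] at e2
    exact ht.2.asymm (hlow t ⟨b_eq_of_leftOf hw ht.1 (le_antisymm e2 e1), h⟩ ht.2.ne)
  · push Not at hA
    have hhigh : ∀ t, D.b t = w → t ≠ s → D.Below t s := fun t ht hne =>
      (below_total hne (hx t (leftOf_of_b_eq ht)) (hx s hs')).resolve_right (hA t ht)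
    have htop : f (D.top (D.UnderRight w)) = f (some s) := by
      rw [← hf w hw, top_underLeft_eq_some hw hs hhigh]
    by_cases hR : ∃ t, D.a t = w
    · -- Go on along the highest segment on the right.
      obtain ⟨s', h1, h2⟩ := exists_highest hR ⟨y, hy⟩
      refine ⟨(s', true), ?_, h1, ?_⟩
      · rintro rfl
        have h3 : D.a s' = w := h1
        have := D.lt s'
        rw [h3, hs] at this
        exact this.false
      · rw [← htop, top_underRight_eq_some hw h1 h2]
        rfl
    · -- Turn back along the lowest segment on the left.
      push Not at hR
      obtain ⟨t₀, hne₀, ht₀⟩ := hother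
      have ht₀ := ht₀.resolve_left (hR t₀)
      obtain ⟨s', h1, h2⟩ := exists_lowest ⟨s, hs⟩ (D.exists_over_of_b_eq w)
      refine ⟨(s', false), ?_, h1, ?_⟩
      · rintro rfl
        exact (h2 t₀ ht₀ hne₀).asymm (hhigh t₀ ht₀ hne₀)
      · change f (D.belowName s') = _
        rw [apply_belowName_eq hf, h1, ← htop]
        congr 1
        apply top_congr
        intro t
        rw [leftOf_below_iff_passesUnder hw h1 h2, underRight_iff_passesUnder hw hR]

/-- The segment that continues the walk around the region on the left of a segment arriving at `w`
from the right. -/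
theorem exists_next_of_a_eq [Finite ι] {α : Type*} {f : Option ι → α}
    (hf : ∀ w ∈ D.points, D.Compatible f w) {w : ℝ × ℝ} (hw : w ∈ D.points) {s : ι}
    (hs : D.a s = w) (hother : ∃ t, t ≠ s ∧ (D.a t = w ∨ D.b t = w)) :
    ∃ d : ι × Bool, d.1 ≠ s ∧ D.tail d = w ∧ f (D.leftName d) = f (D.belowName s) := by
  have hs' := rightOf_of_a_eq hs
  obtain ⟨x, hx⟩ := exists_over_of_rightOf (D := D) w.1
  have hname : D.belowName s = D.top fun t => D.RightOf w.1 t ∧ D.Below t s := by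
    rw [← hs]
    rfl
  by_cases hA : ∃ t, D.a t = w ∧ D.Below t s
  · -- Turn back along the next lower segment on the right.
    obtain ⟨s', ⟨h1, h2⟩, hhigh⟩ := exists_highest hA ⟨x, fun t h => hx t (rightOf_of_a_eq h.1)⟩
    refine ⟨(s', true), h2.ne, h1, ?_⟩
    change f (some s') = _
    rw [hname]
    congr 1
    symm
    have hs1 := rightOf_of_a_eq h1
    refine top_eq_some ⟨hs1, h2⟩ fun t ht hne => ?_
    rcases below_total hne (hx t ht.1) (hx s' hs1) with h | h
    · exact h
    exfalso
    have e1 := h.ht_le ⟨hs1.1, hs1.2.le⟩ ⟨ht.1.1, ht.1.2.le⟩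
    have e2 := ht.2.ht_le ⟨ht.1.1, ht.1.2.le⟩ ⟨hs'.1, hs'.2.le⟩
    rw [ht_of_a_eq h1] at e1
    rw [ht_of_a_eq hs] at e2
    exact h.asymm (hhigh t ⟨a_eq_of_rightOf hw ht.1 (le_antisymm e2 e1), ht.2⟩ hne)
  · push Not at hA
    have hlow : ∀ t, D.a t = w → t ≠ s → D.Below s t := fun t ht hne =>
      (below_total hne (hx t (rightOf_of_a_eq ht)) (hx s hs')).resolve_left (hA t ht)
    by_cases hL : ∃ t, D.b t = w
    · -- Go on along the lowest segment on the left.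
      obtain ⟨s', h1, h2⟩ := exists_lowest hL (D.exists_over_of_b_eq w)
      refine ⟨(s', false), ?_, h1, ?_⟩
      · rintro rfl
        have h3 : D.b s' = w := h1
        have := D.lt s'
        rw [h3, hs] at this
        exact this.false
      · change f (D.belowName s') = _
        rw [apply_belowName_eq hf, h1, hname]
        congr 1
        apply top_congr
        intro t
        rw [leftOf_below_iff_passesUnder hw h1 h2, rightOf_below_iff_passesUnder hw hs hlow]
    · -- Turn back along the highest segment on the right.
      push Not at hL
      obtain ⟨t₀, hne₀, ht₀⟩ := hother
      have ht₀ := ht₀.resolve_right (hL t₀)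
      obtain ⟨s', h1, h2⟩ := exists_highest ⟨s, hs⟩ (D.exists_over_of_a_eq w)
      refine ⟨(s', true), ?_, h1, ?_⟩
      · rintro rfl
        exact (h2 t₀ ht₀ hne₀).asymm (hlow t₀ ht₀ hne₀)
      · change f (some s') = _
        rw [← top_underRight_eq_some hw h1 h2, ← hf w hw, hname]
        congr 1
        apply top_congr
        intro t
        rw [underLeft_iff_passesUnder hw hL, rightOf_below_iff_passesUnder hw hs hlow]

/-- The walk around a region, with the region on its left, can be continued at each point where the
drawing has another segment. -/
theorem exists_next [Finite ι] {α : Type*} {f : Option ι → α}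
    (hf : ∀ w ∈ D.points, D.Compatible f w) (d : ι × Bool)
    (hother : ∃ t, t ≠ d.1 ∧ (D.a t = D.head d ∨ D.b t = D.head d)) :
    ∃ d' : ι × Bool, d'.1 ≠ d.1 ∧ D.tail d' = D.head d ∧
      f (D.leftName d') = f (D.leftName d) := by
  obtain ⟨s, _ | _⟩ := d
  · exact exists_next_of_a_eq hf (D.a_mem s) rfl hother
  · exact exists_next_of_b_eq hf (D.b_mem s) rfl hother

/-- Every region touches a segment. -/
theorem exists_leftName_eq [Finite ι] [Nonempty ι] {α : Type*} {f : Option ι → α}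
    (hf : ∀ w ∈ D.points, D.Compatible f w) (o : Option ι) :
    ∃ s, f (D.leftName (s, true)) = f o := by
  cases o with
  | some s => exact ⟨s, rfl⟩
  | none =>
    obtain ⟨s₀, hmin⟩ := Finite.exists_min fun s => (D.a s).1
    obtain ⟨s, h1, h2⟩ := exists_highest (D := D) (T := fun s => D.a s = D.a s₀) ⟨s₀, rfl⟩
      (D.exists_over_of_a_eq _)
    refine ⟨s, ?_⟩
    change f (some s) = _
    rw [← top_underRight_eq_some (D.a_mem s₀) h1 h2, ← hf _ (D.a_mem s₀),
      top_underLeft_eq_none hmin]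

end StraightDrawing

/-! ### Euler's bound for bipartite polygonal drawings -/

/-- A plane drawing, by polygonal arcs in general position, of the bipartite graph with the set of
edges `E`; the first component of an edge is its end in the one class, the second component its end
in the other class. The edge `e` is drawn as the chain `p e 0, …, p e (m e)`. -/
structure PolylineDrawing {V : Type*} (E : Finset (V × V)) where
  pos : V → ℝ × ℝ
  m : V × V → ℕ
  p : V × V → ℕ → ℝ × ℝ
  fst_ne_snd : ∀ e ∈ E, ∀ f ∈ E, e.1 ≠ f.2
  pos_injective : Function.Injective pos
  m_pos : ∀ e ∈ E, 0 < m e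
  p_zero : ∀ e ∈ E, p e 0 = pos e.1
  p_last : ∀ e ∈ E, p e (m e) = pos e.2
  p_ne : ∀ e ∈ E, ∀ i < m e, p e i ≠ p e (i + 1)
  inter_succ : ∀ e ∈ E, ∀ i, i + 1 < m e → ∀ z, z ∈ segment ℝ (p e i) (p e (i + 1)) →
    z ∈ segment ℝ (p e (i + 1)) (p e (i + 2)) → z = p e (i + 1)
  disjoint : ∀ e ∈ E, ∀ i j, i + 1 < j → j < m e → ∀ z, z ∈ segment ℝ (p e i) (p e (i + 1)) →
    z ∉ segment ℝ (p e j) (p e (j + 1))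
  inter : ∀ e ∈ E, ∀ f ∈ E, e ≠ f → ∀ i < m e, ∀ j < m f, ∀ z,
    z ∈ segment ℝ (p e i) (p e (i + 1)) → z ∈ segment ℝ (p f j) (p f (j + 1)) →
    ∃ w, (w = e.1 ∨ w = e.2) ∧ (w = f.1 ∨ w = f.2) ∧ z = pos w
  fst_inj : ∀ e ∈ E, ∀ i ≤ m e, ∀ f ∈ E, ∀ j ≤ m f, (p e i).1 = (p f j).1 → p e i = p f j

namespace PolylineDrawing

variable {V : Type*} {E : Finset (V × V)}

/-- The same drawing with fewer edges. -/
def mono {E' : Finset (V × V)} (P : PolylineDrawing E) (h : E' ⊆ E) : PolylineDrawing E' where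
  pos := P.pos
  m := P.m
  p := P.p
  fst_ne_snd e he f hf := P.fst_ne_snd e (h he) f (h hf)
  pos_injective := P.pos_injective
  m_pos e he := P.m_pos e (h he)
  p_zero e he := P.p_zero e (h he)
  p_last e he := P.p_last e (h he)
  p_ne e he := P.p_ne e (h he)
  inter_succ e he := P.inter_succ e (h he)
  disjoint e he := P.disjoint e (h he)
  inter e he f hf := P.inter e (h he) f (h hf)
  fst_inj e he i hi f hf := P.fst_inj e (h he) i hi f (h hf)

variable (P : PolylineDrawing E)

theorem eq_or_eq_of_mem {e : V × V} (he : e ∈ E) {i j : ℕ} (hi : i < P.m e) (hj : j ≤ P.m e)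
    (h : P.p e j ∈ segment ℝ (P.p e i) (P.p e (i + 1))) : j = i ∨ j = i + 1 := by
  by_contra hcon
  push Not at hcon
  rcases lt_or_gt_of_ne hcon.1 with hlt | hlt
  · have hjm : P.p e j ∈ segment ℝ (P.p e j) (P.p e (j + 1)) := left_mem_segment ℝ _ _
    rcases Nat.lt_or_ge (j + 1) i with h1 | h1
    · exact P.disjoint e he j i h1 hi _ hjm h
    · obtain rfl : i = j + 1 := by omega
      exact P.p_ne e he j (by omega) (P.inter_succ e he j hi _ hjm h)
  · obtain ⟨k, rfl⟩ : ∃ k, j = k + 1 := ⟨j - 1, by omega⟩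
    have hjm : P.p e (k + 1) ∈ segment ℝ (P.p e k) (P.p e (k + 1)) := right_mem_segment ℝ _ _
    rcases Nat.lt_or_ge (i + 1) k with h1 | h1
    · exact P.disjoint e he i k h1 (by omega) _ h hjm
    · obtain rfl : k = i + 1 := by omega
      exact P.p_ne e he (i + 1) (by omega) (P.inter_succ e he i (by omega) _ h hjm).symm

/-- The end of the edge `e` reached in the direction `β`, where `true` is the direction of
the chain. -/
def endVertex (e : V × V) (β : Bool) : V := if β then e.2 else e.1

/-- The index of the last segment of `e` in the direction `β`. -/
def endIndex (e : V × V) (β : Bool) : ℕ := if β then P.m e - 1 else 0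

/-- The `i`-th segment of `e` arrives at this point in the direction `β`. -/
def tip (e : V × V) (i : ℕ) (β : Bool) : ℝ × ℝ := if β then P.p e (i + 1) else P.p e i

theorem endIndex_lt {e : V × V} (he : e ∈ E) (β : Bool) : P.endIndex e β < P.m e := by
  have := P.m_pos e he
  cases β <;> simp [endIndex] <;> omega

theorem tip_endIndex {e : V × V} (he : e ∈ E) (β : Bool) :
    P.tip e (P.endIndex e β) β = P.pos (endVertex e β) := by
  have := P.m_pos e he
  cases β
  · simp [tip, endIndex, endVertex, P.p_zero e he]
  · have h : P.m e - 1 + 1 = P.m e := by omega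
    simp [tip, endIndex, endVertex, h, P.p_last e he]

theorem tip_mem (e : V × V) (i : ℕ) (β : Bool) :
    P.tip e i β ∈ segment ℝ (P.p e i) (P.p e (i + 1)) := by
  cases β
  · exact left_mem_segment ℝ _ _
  · exact right_mem_segment ℝ _ _

theorem tip_injective {e : V × V} (he : e ∈ E) {i : ℕ} (hi : i < P.m e) {β γ : Bool}
    (h : P.tip e i β = P.tip e i γ) : β = γ := by
  have := P.p_ne e he i hi
  cases β <;> cases γ <;> simp_all [tip]

theorem eq_endIndex_of_mem {e : V × V} (he : e ∈ E) {i : ℕ} (hi : i < P.m e) {β : Bool}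
    (h : P.pos (endVertex e β) ∈ segment ℝ (P.p e i) (P.p e (i + 1))) : i = P.endIndex e β := by
  cases β
  · simp only [endVertex, Bool.false_eq_true, if_false] at h
    rw [← P.p_zero e he] at h
    have := P.eq_or_eq_of_mem he hi (Nat.zero_le _) h
    simp only [endIndex, Bool.false_eq_true, if_false]
    omega
  · simp only [endVertex, if_true] at h
    rw [← P.p_last e he] at h
    have := P.eq_or_eq_of_mem he hi le_rfl h
    simp only [endIndex, if_true]
    omega

theorem exists_endVertex_of_mem {e f : V × V} (he : e ∈ E) (hf : f ∈ E) (hne : e ≠ f) {i j : ℕ}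
    (hi : i < P.m e) (hj : j < P.m f) {z : ℝ × ℝ}
    (hze : z ∈ segment ℝ (P.p e i) (P.p e (i + 1)))
    (hzf : z ∈ segment ℝ (P.p f j) (P.p f (j + 1))) :
    ∃ β, z = P.pos (endVertex e β) ∧ z = P.pos (endVertex f β) ∧ i = P.endIndex e β ∧
      j = P.endIndex f β := by
  obtain ⟨w, hw, hw', rfl⟩ := P.inter e he f hf hne i hi j hj z hze hzf
  have key : ∃ β, endVertex e β = w ∧ endVertex f β = w := by
    rcases hw with rfl | rfl <;> rcases hw' with h | h
    · exact ⟨false, rfl, h.symm⟩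
    · exact absurd h (P.fst_ne_snd e he f hf)
    · exact absurd h.symm (P.fst_ne_snd f hf e he)
    · exact ⟨true, rfl, h.symm⟩
  obtain ⟨β, h1, h2⟩ := key
  refine ⟨β, by rw [h1], by rw [h2], ?_, ?_⟩
  · exact P.eq_endIndex_of_mem he hi (by rwa [h1])
  · exact P.eq_endIndex_of_mem hf hj (by rwa [h2])

/-- The segments of the drawing, named by an edge and the place in its chain. -/
abbrev Seg : Type _ := Σ e : {e // e ∈ E}, Fin (P.m e)

/-- Whether the chain runs to the right along the segment `k`. -/
noncomputable def isRight (k : P.Seg) : Bool :=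
  decide ((P.p k.1 k.2).1 < (P.p k.1 (k.2 + 1)).1)

theorem eq_tip_iff (k : P.Seg) (z : ℝ × ℝ) :
    (z = P.tip k.1 k.2 (!P.isRight k) ∨ z = P.tip k.1 k.2 (P.isRight k)) ↔
      (z = P.p k.1 k.2 ∨ z = P.p k.1 (k.2 + 1)) := by
  cases P.isRight k <;> simp [tip, or_comm]

theorem segment_tip (k : P.Seg) :
    segment ℝ (P.tip k.1 k.2 (!P.isRight k)) (P.tip k.1 k.2 (P.isRight k)) =
      segment ℝ (P.p k.1 k.2) (P.p k.1 (k.2 + 1)) := by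
  cases P.isRight k
  · simp [tip, segment_symm]
  · simp [tip]

/-- The segment `k`, directed along the chain or against it. -/
noncomputable def dart (k : P.Seg) (β : Bool) : P.Seg × Bool := (k, β == P.isRight k)

theorem exists_eq_dart (d : P.Seg × Bool) : ∃ k β, d = P.dart k β := by
  refine ⟨d.1, d.2 == P.isRight d.1, Prod.ext rfl ?_⟩
  simp only [dart]
  cases d.2 <;> cases P.isRight d.1 <;> rfl

variable [DecidableEq V]

/-- The straight-line drawing that consists of all segments of a polygonal drawing. -/
noncomputable def toStraightDrawing : StraightDrawing P.Seg where
  points := E.biUnion fun e => (Finset.range (P.m e + 1)).image (P.p e)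
  a k := P.tip k.1 k.2 (!P.isRight k)
  b k := P.tip k.1 k.2 (P.isRight k)
  a_mem k := by
    simp only [Finset.mem_biUnion, Finset.mem_image, Finset.mem_range]
    refine ⟨k.1, k.1.2, ?_⟩
    cases P.isRight k
    · exact ⟨k.2 + 1, by omega, rfl⟩
    · exact ⟨k.2, by omega, rfl⟩
  b_mem k := by
    simp only [Finset.mem_biUnion, Finset.mem_image, Finset.mem_range]
    refine ⟨k.1, k.1.2, ?_⟩
    cases P.isRight k
    · exact ⟨k.2, by omega, rfl⟩
    · exact ⟨k.2 + 1, by omega, rfl⟩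
  lt k := by
    by_cases h : (P.p k.1 k.2).1 < (P.p k.1 (k.2 + 1)).1
    · have : P.isRight k = true := decide_eq_true h
      rw [this]
      exact h
    · have : P.isRight k = false := decide_eq_false h
      rw [this]
      refine lt_of_le_of_ne (not_lt.1 h) fun e => P.p_ne k.1 k.1.2 k.2 k.2.2 ?_
      exact P.fst_inj _ k.1.2 _ (by omega) _ k.1.2 _ (by omega) e.symm
  fst_inj x hx y hy h := by
    simp only [Finset.mem_biUnion, Finset.mem_image, Finset.mem_range] at hx hy
    obtain ⟨e, he, i, hi, rfl⟩ := hx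
    obtain ⟨f, hf, j, hj, rfl⟩ := hy
    exact P.fst_inj e he i (by omega) f hf j (by omega) h
  eq_end_of_mem q hq k hk := by
    rw [P.eq_tip_iff]
    rw [P.segment_tip] at hk
    simp only [Finset.mem_biUnion, Finset.mem_image, Finset.mem_range] at hq
    obtain ⟨f, hf, j, hj, rfl⟩ := hq
    obtain ⟨⟨e, he⟩, ⟨i, hi⟩⟩ := k
    simp only at hk ⊢
    by_cases hef : e = f
    · subst hef
      rcases P.eq_or_eq_of_mem he hi (by omega) hk with rfl | rfl
      · exact Or.inl rfl
      · exact Or.inr rfl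
    · obtain ⟨j', hj', h'⟩ : ∃ j' < P.m f, P.p f j ∈ segment ℝ (P.p f j') (P.p f (j' + 1)) := by
        rcases Nat.lt_or_ge j (P.m f) with h | h
        · exact ⟨j, h, left_mem_segment ℝ _ _⟩
        · have := P.m_pos f hf
          obtain ⟨l, rfl⟩ : ∃ l, j = l + 1 := ⟨j - 1, by omega⟩
          exact ⟨l, by omega, right_mem_segment ℝ _ _⟩
      obtain ⟨β, h1, -, h3, -⟩ := P.exists_endVertex_of_mem he hf hef hi hj' hk h'
      rw [← P.tip_endIndex he, ← h3] at h1
      rw [h1]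
      cases β
      · exact Or.inl rfl
      · exact Or.inr rfl
  eq_ends_of_mem s t hst z hs ht := by
    rw [P.segment_tip] at hs ht
    rw [P.eq_tip_iff, P.eq_tip_iff]
    obtain ⟨⟨e, he⟩, ⟨i, hi⟩⟩ := s
    obtain ⟨⟨f, hf⟩, ⟨j, hj⟩⟩ := t
    simp only at hs ht ⊢
    by_cases hef : e = f
    · subst hef
      have hij : i ≠ j := fun h => hst (by subst h; rfl)
      -- The two segments belong to the same chain, hence they are consecutive.
      have key : ∀ {i j : ℕ}, i < j → j < P.m e → z ∈ segment ℝ (P.p e i) (P.p e (i + 1)) →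
          z ∈ segment ℝ (P.p e j) (P.p e (j + 1)) → z = P.p e (i + 1) ∧ z = P.p e j := by
        intro i j hlt hj hs ht
        rcases Nat.lt_or_ge (i + 1) j with h | h
        · exact absurd ht (P.disjoint e he i j h hj z hs)
        · obtain rfl : j = i + 1 := by omega
          have := P.inter_succ e he i hj z hs ht
          exact ⟨this, this⟩
      rcases lt_or_gt_of_ne hij with h | h
      · have := key h hj hs ht
        exact ⟨Or.inr this.1, Or.inl this.2⟩
      · have := key h hi ht hs
        exact ⟨Or.inl this.2, Or.inr this.1⟩
    · obtain ⟨β, h1, h2, h3, h4⟩ := P.exists_endVertex_of_mem he hf hef hi hj hs ht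
      rw [← P.tip_endIndex he, ← h3] at h1
      rw [← P.tip_endIndex hf, ← h4] at h2
      cases β
      · exact ⟨Or.inl h1, Or.inl h2⟩
      · exact ⟨Or.inr h1, Or.inr h2⟩

theorem head_dart (k : P.Seg) (β : Bool) :
    P.toStraightDrawing.head (P.dart k β) = P.tip k.1 k.2 β := by
  simp only [StraightDrawing.head, dart, toStraightDrawing]
  cases β <;> rcases Bool.eq_false_or_eq_true (P.isRight k) with h | h <;> simp [h]

theorem tail_dart (k : P.Seg) (β : Bool) :
    P.toStraightDrawing.tail (P.dart k β) = P.tip k.1 k.2 (!β) := by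
  simp only [StraightDrawing.tail, dart, toStraightDrawing]
  cases β <;> rcases Bool.eq_false_or_eq_true (P.isRight k) with h | h <;> simp [h]

theorem exists_next_dart {α : Type*} {f : Option P.Seg → α}
    (hf : ∀ w ∈ P.toStraightDrawing.points, P.toStraightDrawing.Compatible f w)
    (k l : P.Seg) (β γ : Bool) (hkl : l ≠ k) (hl : P.tip l.1 l.2 γ = P.tip k.1 k.2 β) :
    ∃ (k' : P.Seg) (β' : Bool), k' ≠ k ∧ P.tip k'.1 k'.2 (!β') = P.tip k.1 k.2 β ∧
      f (P.toStraightDrawing.leftName (P.dart k' β')) =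
        f (P.toStraightDrawing.leftName (P.dart k β)) := by
  obtain ⟨d, h1, h2, h3⟩ := StraightDrawing.exists_next hf (P.dart k β) ⟨l, hkl, by
    rw [head_dart, ← hl]
    simp only [toStraightDrawing]
    cases P.isRight l <;> cases γ <;> simp⟩
  obtain ⟨k', β', rfl⟩ := P.exists_eq_dart d
  rw [head_dart, tail_dart] at h2
  exact ⟨k', β', h1, h2, h3⟩

/-- The region on the left of a chain does not change along the chain. -/
theorem leftName_dart_succ {α : Type*} {f : Option P.Seg → α}
    (hf : ∀ w ∈ P.toStraightDrawing.points, P.toStraightDrawing.Compatible f w)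
    {e : V × V} (he : e ∈ E) {i : ℕ} (hi : i + 1 < P.m e) (β : Bool) :
    f (P.toStraightDrawing.leftName (P.dart ⟨⟨e, he⟩, ⟨i + 1, hi⟩⟩ β)) =
      f (P.toStraightDrawing.leftName (P.dart ⟨⟨e, he⟩, ⟨i, Nat.lt_of_succ_lt hi⟩⟩ β)) := by
  have touch : ∀ (k : P.Seg) (β : Bool), P.tip k.1 k.2 β = P.p e (i + 1) →
      k.1.1 = e ∧ ((k.2 : ℕ) = i ∧ β = true ∨ (k.2 : ℕ) = i + 1 ∧ β = false) := by
    rintro ⟨⟨e', he'⟩, ⟨j, hj⟩⟩ β h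
    simp only at h ⊢
    have hz := P.tip_mem e' j β
    rw [h] at hz
    have hz' : P.p e (i + 1) ∈ segment ℝ (P.p e i) (P.p e (i + 1)) := right_mem_segment ℝ _ _
    by_cases hee : e' = e
    · subst hee
      refine ⟨rfl, ?_⟩
      have h1 := P.eq_or_eq_of_mem he hj hi.le hz
      cases β
      · right
        refine ⟨?_, rfl⟩
        simp only [tip, Bool.false_eq_true, if_false] at h
        by_contra hne
        have hj1 : j = i := by omega
        subst hj1
        exact P.p_ne e' he j (by omega) h
      · left
        refine ⟨?_, rfl⟩
        simp only [tip, if_true] at h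
        by_contra hne
        have hj1 : j = i + 1 := by omega
        subst hj1
        exact P.p_ne e' he (i + 1) (by omega) h.symm
    · exfalso
      have hz2 : P.p e (i + 1) ∈ segment ℝ (P.p e (i + 1)) (P.p e (i + 1 + 1)) :=
        left_mem_segment ℝ _ _
      obtain ⟨γ, a1, -, -, a4⟩ := P.exists_endVertex_of_mem he' he hee hj (by omega : i < _) hz hz'
      obtain ⟨γ', b1, -, -, b4⟩ := P.exists_endVertex_of_mem he' he hee hj hi hz hz2
      have h5 : endVertex e' γ = endVertex e' γ' := P.pos_injective (a1.symm.trans b1)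
      have h6 : γ = γ' := by
        have := P.fst_ne_snd e' he' e' he'
        cases γ <;> cases γ' <;> simp_all [endVertex]
      subst h6
      omega
  cases β
  · obtain ⟨k', β', h1, h2, h3⟩ := P.exists_next_dart hf ⟨⟨e, he⟩, ⟨i + 1, hi⟩⟩
      ⟨⟨e, he⟩, ⟨i, Nat.lt_of_succ_lt hi⟩⟩ false true (by
        intro h
        have := congrArg (fun k : P.Seg => (k.2 : ℕ)) h
        simp at this) rfl
    obtain ⟨⟨e', he'⟩, ⟨j, hj⟩⟩ := k'
    obtain ⟨h4, h5⟩ := touch _ _ h2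
    simp only at h4 h5
    subst h4
    rcases h5 with ⟨rfl, h6⟩ | ⟨rfl, h6⟩
    · rw [← h3]
      cases β'
      · rfl
      · simp at h6
    · exact absurd rfl h1
  · obtain ⟨k', β', h1, h2, h3⟩ := P.exists_next_dart hf ⟨⟨e, he⟩, ⟨i, Nat.lt_of_succ_lt hi⟩⟩
      ⟨⟨e, he⟩, ⟨i + 1, hi⟩⟩ true false (by
        intro h
        have := congrArg (fun k : P.Seg => (k.2 : ℕ)) h
        simp at this) rfl
    obtain ⟨⟨e', he'⟩, ⟨j, hj⟩⟩ := k'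
    obtain ⟨h4, h5⟩ := touch _ _ h2
    simp only at h4 h5
    subst h4
    rcases h5 with ⟨rfl, h6⟩ | ⟨rfl, h6⟩
    · exact absurd rfl h1
    · rw [← h3]
      cases β'
      · simp at h6
      · rfl

theorem leftName_dart_eq {α : Type*} {f : Option P.Seg → α}
    (hf : ∀ w ∈ P.toStraightDrawing.points, P.toStraightDrawing.Compatible f w)
    {e : V × V} (he : e ∈ E) {i j : ℕ} (hi : i < P.m e) (hj : j < P.m e) (β : Bool) :
    f (P.toStraightDrawing.leftName (P.dart ⟨⟨e, he⟩, ⟨i, hi⟩⟩ β)) =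
      f (P.toStraightDrawing.leftName (P.dart ⟨⟨e, he⟩, ⟨j, hj⟩⟩ β)) := by
  have key : ∀ i (hi : i < P.m e),
      f (P.toStraightDrawing.leftName (P.dart ⟨⟨e, he⟩, ⟨i, hi⟩⟩ β)) =
        f (P.toStraightDrawing.leftName (P.dart ⟨⟨e, he⟩, ⟨0, P.m_pos e he⟩⟩ β)) := by
    intro i
    induction i with
    | zero => exact fun _ => rfl
    | succ i ih => exact fun hi => (P.leftName_dart_succ hf he hi β).trans (ih (by omega))
  rw [key i hi, key j hj]

/-- The region on the left of the edge `e`, directed by `β`. -/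
noncomputable def leftRegion {α : Type*} (f : Option P.Seg → α) (d : {e // e ∈ E} × Bool) : α :=
  f (P.toStraightDrawing.leftName (P.dart ⟨d.1, ⟨0, P.m_pos d.1 d.1.2⟩⟩ d.2))

theorem exists_next_edge {α : Type*} {f : Option P.Seg → α}
    (hf : ∀ w ∈ P.toStraightDrawing.points, P.toStraightDrawing.Compatible f w)
    (hdeg : ∀ e ∈ E, ∀ β, ∃ e' ∈ E, e' ≠ e ∧ endVertex e' β = endVertex e β)
    (e : {e // e ∈ E}) (β : Bool) :
    ∃ e' : {e // e ∈ E}, e' ≠ e ∧ endVertex e'.1 β = endVertex e.1 β ∧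
      P.leftRegion f (e', !β) = P.leftRegion f (e, β) := by
  obtain ⟨e, he⟩ := e
  obtain ⟨e₁, he₁, hne₁, hend₁⟩ := hdeg e he β
  obtain ⟨⟨⟨e', he'⟩, ⟨j, hj⟩⟩, β', h1, h2, h3⟩ := P.exists_next_dart hf
    ⟨⟨e, he⟩, ⟨P.endIndex e β, P.endIndex_lt he β⟩⟩
    ⟨⟨e₁, he₁⟩, ⟨P.endIndex e₁ β, P.endIndex_lt he₁ β⟩⟩ β β
    (fun h => hne₁ (congrArg (fun k : P.Seg => k.1.1) h))
    (by simp only [tip_endIndex, he, he₁, hend₁])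
  simp only at h2
  have hz := P.tip_mem e' j (!β')
  have hz' := P.tip_mem e (P.endIndex e β) β
  rw [h2] at hz
  have hne : e' ≠ e := by
    rintro rfl
    rw [P.tip_endIndex he] at hz
    have := P.eq_endIndex_of_mem he hj hz
    subst this
    exact h1 rfl
  obtain ⟨γ, a1, a2, a3, a4⟩ := P.exists_endVertex_of_mem he' he hne hj (P.endIndex_lt he β) hz hz'
  rw [P.tip_endIndex he] at a1 a2
  have hγ : γ = β := by
    have h5 := P.pos_injective a2
    have := P.fst_ne_snd e he e he
    cases γ <;> cases β <;> simp_all [endVertex]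
  subst hγ
  refine ⟨⟨e', he'⟩, fun h => hne (congrArg Subtype.val h), (P.pos_injective a1).symm, ?_⟩
  have hβ : (!β') = γ := by
    apply P.tip_injective he' hj
    rw [h2, P.tip_endIndex he, a1, a3, P.tip_endIndex he']
  rw [← hβ, Bool.not_not]
  unfold leftRegion
  rw [hβ, P.leftName_dart_eq hf he' _ hj, h3]
  exact P.leftName_dart_eq hf he _ _ γ

/-- Euler's bound under the assumption that no edge has an end of degree one: then a walk around
a region has length at least four. -/
theorem card_add_four_le_of_degree (P : PolylineDrawing E) (hE : E.Nonempty)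
    (hdeg : ∀ e ∈ E, ∀ β, ∃ e' ∈ E, e' ≠ e ∧ endVertex e' β = endVertex e β) :
    E.card + 4 ≤ 2 * (E.image Prod.fst ∪ E.image Prod.snd).card := by
  classical
  obtain ⟨e₀, he₀⟩ := hE
  have : Nonempty P.Seg := ⟨⟨⟨e₀, he₀⟩, ⟨0, P.m_pos e₀ he₀⟩⟩⟩
  let s₀ : P.Seg := Classical.arbitrary _
  obtain ⟨f, hf, hcard⟩ := P.toStraightDrawing.exists_compatible ⟨_, P.toStraightDrawing.a_mem s₀⟩
  -- The points are the vertices and the `m e - 1` bends of each edge `e`.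
  have hseg : Fintype.card P.Seg = ∑ e ∈ E, P.m e := by
    rw [Fintype.card_sigma]
    simp only [Fintype.card_fin]
    exact Finset.sum_coe_sort E P.m
  have hpoints : P.toStraightDrawing.points.card ≤
      (E.image Prod.fst ∪ E.image Prod.snd).card + ∑ e ∈ E, (P.m e - 1) := by
    have hsub : P.toStraightDrawing.points ⊆
        (E.image Prod.fst ∪ E.image Prod.snd).image P.pos ∪
          E.biUnion fun e => (Finset.Ioo 0 (P.m e)).image (P.p e) := by
      intro x hx
      simp only [toStraightDrawing, Finset.mem_biUnion, Finset.mem_image, Finset.mem_range] at hx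
      obtain ⟨e, he, i, hi, rfl⟩ := hx
      rcases Nat.eq_zero_or_pos i with rfl | h0
      · rw [P.p_zero e he]
        exact Finset.mem_union_left _ (Finset.mem_image_of_mem _
          (Finset.mem_union_left _ (Finset.mem_image_of_mem _ he)))
      rcases Nat.lt_or_ge i (P.m e) with h1 | h1
      · exact Finset.mem_union_right _ (Finset.mem_biUnion.2 ⟨e, he,
          Finset.mem_image_of_mem _ (Finset.mem_Ioo.2 ⟨h0, h1⟩)⟩)
      · obtain rfl : i = P.m e := by omega
        rw [P.p_last e he]
        exact Finset.mem_union_left _ (Finset.mem_image_of_mem _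
          (Finset.mem_union_right _ (Finset.mem_image_of_mem _ he)))
    refine (Finset.card_le_card hsub).trans ((Finset.card_union_le _ _).trans ?_)
    refine Nat.add_le_add Finset.card_image_le (Finset.card_biUnion_le.trans ?_)
    refine Finset.sum_le_sum fun e _ => Finset.card_image_le.trans ?_
    simp
  have hsum : ∑ e ∈ E, (P.m e - 1) + E.card = ∑ e ∈ E, P.m e := by
    rw [Finset.card_eq_sum_ones, ← Finset.sum_add_distrib]
    refine Finset.sum_congr rfl fun e he => ?_
    have := P.m_pos e he
    omega
  have himage : Finset.univ.image f = Finset.univ.image (P.leftRegion f) := by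
    apply Finset.Subset.antisymm
    · intro y hy
      obtain ⟨o, -, rfl⟩ := Finset.mem_image.1 hy
      obtain ⟨s, hs⟩ := StraightDrawing.exists_leftName_eq hf o
      obtain ⟨⟨⟨e, he⟩, ⟨j, hj⟩⟩, β, hd⟩ := P.exists_eq_dart (s, true)
      rw [← hs, hd]
      exact Finset.mem_image.2 ⟨(⟨e, he⟩, β), Finset.mem_univ _, P.leftName_dart_eq hf he _ _ β⟩
    · intro y hy
      obtain ⟨d, -, rfl⟩ := Finset.mem_image.1 hy
      exact Finset.mem_image_of_mem _ (Finset.mem_univ _)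
  have hfour : 4 * (Finset.univ.image (P.leftRegion f)).card ≤
      (Finset.univ : Finset ({e // e ∈ E} × Bool)).card := by
    apply Finset.mul_card_image_le_card
    intro y hy
    obtain ⟨⟨e, β⟩, -, rfl⟩ := Finset.mem_image.1 hy
    obtain ⟨e₁, n1, v1, r1⟩ := P.exists_next_edge hf hdeg e β
    obtain ⟨e₂, n2, v2, r2⟩ := P.exists_next_edge hf hdeg e₁ (!β)
    obtain ⟨e₃, n3, v3, r3⟩ := P.exists_next_edge hf hdeg e₂ β
    rw [Bool.not_not] at r2
    have ext : ∀ e e' : {e // e ∈ E}, endVertex e.1 β = endVertex e'.1 β →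
        endVertex e.1 (!β) = endVertex e'.1 (!β) → e = e' := by
      intro e e' h h'
      apply Subtype.ext
      cases β
      · exact Prod.ext h h'
      · exact Prod.ext h' h
    have d1 : e ≠ e₂ := fun h => n1 (ext _ _ v1 (by rw [h, v2]))
    have d2 : e₁ ≠ e₃ := fun h => n2 (ext _ _ (by rw [h, v3]) v2)
    have hsub : ({(e, β), (e₁, !β), (e₂, β), (e₃, !β)} : Finset _) ⊆
        Finset.univ.filter fun d => P.leftRegion f d = P.leftRegion f (e, β) := by
      intro d hd
      simp only [Finset.mem_insert, Finset.mem_singleton] at hd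
      simp only [Finset.mem_filter, Finset.mem_univ, true_and]
      rcases hd with rfl | rfl | rfl | rfl
      · rfl
      · exact r1
      · exact r2.trans r1
      · exact r3.trans (r2.trans r1)
    refine le_trans (le_of_eq ?_) (Finset.card_le_card hsub)
    rw [Finset.card_insert_of_notMem, Finset.card_insert_of_notMem, Finset.card_insert_of_notMem,
      Finset.card_singleton] <;> simp [d1, d2]
  have huniv : (Finset.univ : Finset ({e // e ∈ E} × Bool)).card = 2 * E.card := by
    simp [Finset.card_univ, mul_comm]
  rw [himage] at hcard
  omega

/-- Euler's bound: a bipartite plane graph with at least two edges and with `v` vertices that are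
not isolated has at most `2v - 4` edges. -/
theorem card_add_four_le (P : PolylineDrawing E) (hE : 2 ≤ E.card) :
    E.card + 4 ≤ 2 * (E.image Prod.fst ∪ E.image Prod.snd).card := by
  induction hn : E.card using Nat.strong_induction_on generalizing E with
  | _ n ih =>
    subst hn
    by_cases hdeg : ∀ e ∈ E, ∀ β, ∃ e' ∈ E, e' ≠ e ∧ endVertex e' β = endVertex e β
    · exact P.card_add_four_le_of_degree (Finset.card_pos.1 (by omega)) hdeg
    · push Not at hdeg
      obtain ⟨e, he, β, hleaf⟩ := hdeg
      have hcard : (E.erase e).card = E.card - 1 := Finset.card_erase_of_mem he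
      set S := E.image Prod.fst ∪ E.image Prod.snd with hS
      set S' := (E.erase e).image Prod.fst ∪ (E.erase e).image Prod.snd with hS'
      have hmem : ∀ f ∈ E, ∀ γ, endVertex f γ ∈ S := by
        intro f hf γ
        cases γ
        · exact Finset.mem_union_left _ (Finset.mem_image_of_mem _ hf)
        · exact Finset.mem_union_right _ (Finset.mem_image_of_mem _ hf)
      have hsub : S' ⊆ S := Finset.union_subset_union
        (Finset.image_subset_image (Finset.erase_subset _ _))
        (Finset.image_subset_image (Finset.erase_subset _ _))
      have hnot : endVertex e β ∉ S' := by
        intro h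
        simp only [hS', Finset.mem_union, Finset.mem_image, Finset.mem_erase] at h
        rcases h with ⟨f, ⟨hne, hf⟩, h⟩ | ⟨f, ⟨hne, hf⟩, h⟩
        · cases β
          · exact hleaf f hf hne h
          · exact P.fst_ne_snd f hf e he h
        · cases β
          · exact P.fst_ne_snd e he f hf h.symm
          · exact hleaf f hf hne h
      have hlt : S'.card < S.card := Finset.card_lt_card
        ((Finset.ssubset_iff_of_subset hsub).2 ⟨_, hmem e he β, hnot⟩)
      rcases Nat.lt_or_ge E.card 3 with h3 | h3
      · -- Two edges have at least three ends.
        obtain ⟨f, hf⟩ : (E.erase e).Nonempty := Finset.card_pos.1 (by omega)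
        have hfE := Finset.mem_of_mem_erase hf
        have hne : f.1 ≠ f.2 := P.fst_ne_snd f hfE f hfE
        have : ({f.1, f.2} : Finset V) ⊆ S' := by
          intro w hw
          simp only [Finset.mem_insert, Finset.mem_singleton] at hw
          rcases hw with rfl | rfl
          · exact Finset.mem_union_left _ (Finset.mem_image_of_mem _ hf)
          · exact Finset.mem_union_right _ (Finset.mem_image_of_mem _ hf)
        have := Finset.card_le_card this
        rw [Finset.card_pair hne] at this
        omega
      · have := ih _ (by omega) (P.mono (Finset.erase_subset e E)) (by omega) rfl
        rw [← hS'] at this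
        omega

end PolylineDrawing

/-! ### The thickness of `K_{1,n,n}` -/

theorem exists_shear_injOn (Q : Finset (ℝ × ℝ)) :
    ∃ ε : ℝ, ∀ x ∈ Q, ∀ y ∈ Q, x.1 + ε * x.2 = y.1 + ε * y.2 → x = y := by
  classical
  obtain ⟨ε, hε⟩ := Infinite.exists_notMem_finset
    ((Q ×ˢ Q).image fun z => (z.1.1 - z.2.1) / (z.2.2 - z.1.2))
  refine ⟨ε, fun x hx y hy h => ?_⟩
  by_cases h2 : x.2 = y.2
  · refine Prod.ext ?_ h2
    rw [h2] at h
    linarith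
  · exfalso
    refine hε (Finset.mem_image.2 ⟨(x, y), Finset.mk_mem_product hx hy, ?_⟩)
    rw [div_eq_iff (sub_ne_zero.2 (Ne.symm h2))]
    linarith

/-- After a generic shear, a plane drawing of a bipartite graph is in general position. -/
theorem PlaneDrawing.nonempty_polylineDrawing {V : Type*} {G : SimpleGraph V} (D : PlaneDrawing G)
    (E : Finset (V × V)) (hadj : ∀ e ∈ E, G.Adj e.1 e.2)
    (hside : ∀ e ∈ E, ∀ f ∈ E, e.1 ≠ f.2) : Nonempty (PolylineDrawing E) := by
  classical
  have hex : ∀ e : V × V, ∃ (m : ℕ) (p : ℕ → ℝ × ℝ), e ∈ E →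
      0 < m ∧ p 0 = D.pos e.1 ∧ p m = D.pos e.2 ∧
      (∀ i < m, p i ≠ p (i + 1)) ∧
      (∀ i, i + 1 < m →
        segment ℝ (p i) (p (i + 1)) ∩ segment ℝ (p (i + 1)) (p (i + 2)) = {p (i + 1)}) ∧
      (∀ i j, i + 1 < j → j < m →
        Disjoint (segment ℝ (p i) (p (i + 1))) (segment ℝ (p j) (p (j + 1)))) ∧
      D.arc s(e.1, e.2) = ⋃ i ∈ Set.Iio m, segment ℝ (p i) (p (i + 1)) := by
    intro e
    by_cases he : e ∈ E
    · obtain ⟨m, p, h⟩ := D.isPolygonalArc _ _ (hadj e he)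
      exact ⟨m, p, fun _ => h⟩
    · exact ⟨0, fun _ => 0, fun h => absurd h he⟩
  choose m p h using hex
  obtain ⟨ε, hε⟩ := exists_shear_injOn (E.biUnion fun e => (Finset.range (m e + 1)).image (p e))
  let φ : (ℝ × ℝ) →ₗ[ℝ] (ℝ × ℝ) :=
    (LinearMap.fst ℝ ℝ ℝ + ε • LinearMap.snd ℝ ℝ ℝ).prod (LinearMap.snd ℝ ℝ ℝ)
  have hφ : Function.Injective φ := by
    intro x y hxy
    obtain ⟨h1, h2⟩ : x.1 + ε * x.2 = y.1 + ε * y.2 ∧ x.2 = y.2 := Prod.ext_iff.1 hxy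
    refine Prod.ext ?_ h2
    rw [h2] at h1
    linarith
  have hseg : ∀ a b z, z ∈ segment ℝ (φ a) (φ b) → ∃ y ∈ segment ℝ a b, φ y = z := by
    intro a b z hz
    rwa [← LinearMap.coe_toAffineMap, ← image_segment] at hz
  have harc : ∀ e ∈ E, ∀ i < m e, ∀ z ∈ segment ℝ (p e i) (p e (i + 1)),
      z ∈ D.arc s(e.1, e.2) := by
    intro e he i hi z hz
    rw [(h e he).2.2.2.2.2.2]
    exact Set.mem_iUnion₂.2 ⟨i, hi, hz⟩
  refine ⟨{
    pos := fun v => φ (D.pos v)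
    m := m
    p := fun e i => φ (p e i)
    fst_ne_snd := hside
    pos_injective := hφ.comp D.pos_injective
    m_pos := fun e he => (h e he).1
    p_zero := fun e he => congrArg φ (h e he).2.1
    p_last := fun e he => congrArg φ (h e he).2.2.1
    p_ne := fun e he i hi => hφ.ne ((h e he).2.2.2.1 i hi)
    inter_succ := ?_
    disjoint := ?_
    inter := ?_
    fst_inj := ?_ }⟩
  · intro e he i hi z hz hz'
    obtain ⟨y, hy, rfl⟩ := hseg _ _ _ hz
    obtain ⟨y', hy', hyy⟩ := hseg _ _ _ hz'
    obtain rfl := hφ hyy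
    have : y' ∈ ({p e (i + 1)} : Set (ℝ × ℝ)) := (h e he).2.2.2.2.1 i hi ▸ ⟨hy, hy'⟩
    rw [Set.mem_singleton_iff.1 this]
  · intro e he i j hij hj z hz hz'
    obtain ⟨y, hy, rfl⟩ := hseg _ _ _ hz
    obtain ⟨y', hy', hyy⟩ := hseg _ _ _ hz'
    obtain rfl := hφ hyy
    exact Set.disjoint_left.1 ((h e he).2.2.2.2.2.1 i j hij hj) hy hy'
  · intro e he f hf hef i hi j hj z hz hz'
    obtain ⟨y, hy, rfl⟩ := hseg _ _ _ hz
    obtain ⟨y', hy', hyy⟩ := hseg _ _ _ hz'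
    obtain rfl := hφ hyy
    have hne : s(e.1, e.2) ≠ s(f.1, f.2) := by
      intro heq
      rcases Sym2.eq_iff.1 heq with ⟨h1, h2⟩ | ⟨h1, -⟩
      · exact hef (Prod.ext h1 h2)
      · exact hside e he f hf h1
    obtain ⟨w, hw, hw', rfl⟩ := D.edge_inter_edge _ (hadj e he) _ (hadj f hf) hne y'
      ⟨harc e he i hi _ hy, harc f hf j hj _ hy'⟩
    exact ⟨w, Sym2.mem_iff.1 hw, Sym2.mem_iff.1 hw', rfl⟩
  · intro e he i hi f hf j hj heq
    refine congrArg φ (hε _ ?_ _ ?_ heq)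
    · exact Finset.mem_biUnion.2 ⟨e, he, Finset.mem_image_of_mem _ (Finset.mem_range.2 (by omega))⟩
    · exact Finset.mem_biUnion.2 ⟨f, hf, Finset.mem_image_of_mem _ (Finset.mem_range.2 (by omega))⟩

/-- A planar subgraph of `K_{1,n,n}` has at most `4n - 4` edges between the two large parts. -/
theorem card_le_of_isPlanar {n : ℕ} (hn : 2 ≤ n) (H : (completeTripartite 1 n n).Subgraph)
    (hH : IsPlanar H.coe) [DecidablePred fun e : Fin n × Fin n => H.Adj ⟨1, e.1⟩ ⟨2, e.2⟩] :
    (Finset.univ.filter fun e : Fin n × Fin n => H.Adj ⟨1, e.1⟩ ⟨2, e.2⟩).card ≤ 4 * n - 4 := by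
  classical
  set F := Finset.univ.filter fun e : Fin n × Fin n => H.Adj ⟨1, e.1⟩ ⟨2, e.2⟩
  have hF : ∀ e ∈ F, H.Adj ⟨1, e.1⟩ ⟨2, e.2⟩ := fun e he => (Finset.mem_filter.1 he).2
  let g : {e // e ∈ F} → H.verts × H.verts := fun e =>
    (⟨⟨1, e.1.1⟩, H.edge_vert (hF e.1 e.2)⟩, ⟨⟨2, e.1.2⟩, H.edge_vert (hF e.1 e.2).symm⟩)
  have hg : Function.Injective g := by
    intro e f hef
    have h1 := congrArg (fun z : H.verts × H.verts => z.1.1) hef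
    have h2 := congrArg (fun z : H.verts × H.verts => z.2.1) hef
    simp only [g] at h1 h2
    exact Subtype.ext (Prod.ext (eq_of_heq (Sigma.mk.inj h1).2) (eq_of_heq (Sigma.mk.inj h2).2))
  let E : Finset (H.verts × H.verts) := Finset.univ.image g
  have hE : E.card = F.card := by
    rw [Finset.card_image_of_injective _ hg, Finset.card_univ, Fintype.card_coe]
  obtain ⟨D⟩ := hH
  obtain ⟨P⟩ := D.nonempty_polylineDrawing E
    (by
      intro e he
      obtain ⟨e, -, rfl⟩ := Finset.mem_image.1 he
      exact hF e.1 e.2)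
    (by
      intro e he f hf hef
      obtain ⟨e, -, rfl⟩ := Finset.mem_image.1 he
      obtain ⟨f, -, rfl⟩ := Finset.mem_image.1 hf
      have := congrArg (fun z : H.verts => z.1.1) hef
      simp [g] at this)
  rcases Nat.lt_or_ge E.card 2 with h2 | h2
  · omega
  · have h4 := P.card_add_four_le h2
    have hsupp : (E.image Prod.fst ∪ E.image Prod.snd).card ≤ 2 * n := by
      have hsub : (E.image Prod.fst ∪ E.image Prod.snd).image Subtype.val ⊆
          (Finset.univ.erase ⟨0, (0 : Fin 1)⟩ :
            Finset (Σ i : Fin 3, Fin ((![1, n, n] : Fin 3 → ℕ) i))) := by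
        intro z hz
        obtain ⟨w, hw, rfl⟩ := Finset.mem_image.1 hz
        refine Finset.mem_erase.2 ⟨fun h => ?_, Finset.mem_univ _⟩
        have h0 : w.1.1 = 0 := congrArg Sigma.fst h
        rcases Finset.mem_union.1 hw with hw | hw
        all_goals
          obtain ⟨e, he, rfl⟩ := Finset.mem_image.1 hw
          obtain ⟨e, -, rfl⟩ := Finset.mem_image.1 he
          simp [g] at h0
      have := Finset.card_le_card hsub
      rw [Finset.card_image_of_injective _ Subtype.val_injective,
        Finset.card_erase_of_mem (Finset.mem_univ _), Finset.card_univ, Fintype.card_sigma,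
        Fin.sum_univ_three] at this
      change _ ≤ Fintype.card (Fin 1) + Fintype.card (Fin n) + Fintype.card (Fin n) - 1 at this
      simp only [Fintype.card_fin] at this
      omega
    omega

theorem le_of_isUnionOfPlanarSubgraphs {n k : ℕ} (hn : 1 ≤ n)
    (h : IsUnionOfPlanarSubgraphs (completeTripartite 1 n n) k) : (n + 1) / 4 + 1 ≤ k := by
  classical
  obtain ⟨H, hH, hsup⟩ := h
  have hcover : ∀ e : Fin n × Fin n, ∃ i, (H i).Adj ⟨1, e.1⟩ ⟨2, e.2⟩ := by
    intro e
    have : (⨆ i, H i).Adj ⟨1, e.1⟩ ⟨2, e.2⟩ := by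
      rw [hsup]
      simp
    exact SimpleGraph.Subgraph.iSup_adj.1 this
  rcases hn.lt_or_eq with hn | rfl
  · have hcount : n * n ≤ ∑ i : Fin k, (4 * n - 4) := by
      calc n * n = (Finset.univ : Finset (Fin n × Fin n)).card := by simp
        _ ≤ (Finset.univ.biUnion fun i : Fin k => Finset.univ.filter fun e : Fin n × Fin n =>
              (H i).Adj ⟨1, e.1⟩ ⟨2, e.2⟩).card := by
            apply Finset.card_le_card
            intro e _
            obtain ⟨i, hi⟩ := hcover e
            exact Finset.mem_biUnion.2 ⟨i, Finset.mem_univ _,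
              Finset.mem_filter.2 ⟨Finset.mem_univ _, hi⟩⟩
        _ ≤ _ := Finset.card_biUnion_le.trans
            (Finset.sum_le_sum fun i _ => card_le_of_isPlanar hn (H i) (hH i))
    rw [Finset.sum_const, Finset.card_univ, Fintype.card_fin, smul_eq_mul] at hcount
    by_contra hcon
    -- From `4k ≤ n + 1` it would follow that `n ^ 2 ≤ (n + 1) * (n - 1)`.
    have h4 : 4 * k ≤ n + 1 := by omega
    obtain ⟨l, rfl⟩ : ∃ l, n = l + 1 := ⟨n - 1, by omega⟩
    have h5 : 4 * (l + 1) - 4 = 4 * l := by omega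
    rw [h5] at hcount
    nlinarith
  · obtain ⟨i, -⟩ := hcover (0, 0)
    have := i.2
    omega

theorem ceil_add_two_div_four (n : ℕ) : ⌈((n : ℚ) + 2) / 4⌉₊ = (n + 1) / 4 + 1 := by
  rw [Nat.ceil_eq_iff (by omega)]
  have h1 : 4 * ((n + 1) / 4) ≤ n + 1 := by omega
  have h2 : n ≤ 4 * ((n + 1) / 4) + 2 := by omega
  generalize (n + 1) / 4 = q at h1 h2 ⊢
  have h1' : 4 * (q : ℚ) ≤ n + 1 := by exact_mod_cast h1
  have h2' : (n : ℚ) ≤ 4 * q + 2 := by exact_mod_cast h2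
  constructor
  · simp only [Nat.add_sub_cancel]
    linarith
  · push_cast
    linarith

theorem theorem2p4 (n : ℕ) (hn : 1 ≤ n) :
    thickness (completeTripartite 1 n n) = ((⌈((n : ℚ) + 2) / 4⌉₊ : ℕ) : ℕ∞) := by
  rw [ceil_add_two_div_four]
  apply le_antisymm
  · exact sInf_le ⟨_, rfl, isUnionOfPlanarSubgraphs_completeTripartite (by omega)⟩
  · refine le_sInf ?_
    rintro _ ⟨k, rfl, hk⟩
    exact_mod_cast le_of_isUnionOfPlanarSubgraphs hn hk
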